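/- **Setting.** Let $\mathbb D$ be the open unit disk in $\mathbb C$, and let $\sigma$ be the normalized arc length measure on $\partial\mathbb D$. For integrable $h$ on $\partial\mathbb D$ (scalar- or vector-valued) let $P[h](t)=\int_{\partial\mathbb D}\frac{1-|t|^2}{|s-t|^2}\,h(s)\,d\sigma(s)$, $t\in\mathbb D$, be its Poisson extension. For $z,w\in\mathbb C^n$ put $z\cdot w=\sum_j z_jw_j$. For $r\ge 1$, $H^r(\mathbb D,\mathbb C^n)$ is the space of holomorphic $F:\mathbb D\to\mathbb C^n$ of the form $F=P[f]$ with $f\in L^r(\partial\mathbb D,\mathbb C^n)$; we write $F(s):=f(s)$ for the boundary values, which are determined for almost every $s\in\partial\mathbb D$. Let $p\in(1,\infty)$, $q=p/(p-1)$, and let $\phi:\partial\mathbb D\times\mathbb C^n\to\mathbb R$ be Borel measurable, with $\phi_s:=\phi(s,\cdot)$ convex for each $s\in\partial\mathbb D$, and such that for some constants $c,C,A>0$ $$c|w|^p-A\le \phi_s(w)\le C|w|^p+A\qquad(s\in\partial\mathbb D,\ w\in\mathbb C^n).$$ Let $\phi^*(s,z)=\phi_s^*(z)=\sup_{w\in\mathbb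 C^n}\{\mathrm{Re}(z\cdot w)-\phi_s(w)\}$ be the fiberwise Legendre transform; it satisfies conditions of the same form with $q$ in place of $p$. For $t\in\mathbb D$, $w\in\mathbb C^n$ define the interpolant $$[\phi](t,w)=[\phi]_t(w)=\sup\big\{\mathrm{Re}(f(t)\cdot w)-P[\mathrm{Re} f_0](t)\ :\ f_0\in L^1(\partial\mathbb D,\mathbb C),\ f\in H^q(\mathbb D,\mathbb C^n),\ \phi_s^*(f(s))\le \mathrm{Re} f_0(s)\text{ for a.e. }s\in\partial\mathbb D\big\},$$ which is a finite real number, and the family of leaves $$\mathcal F(\phi)=\big\{F\in H^p(\mathbb D,\mathbb C^n)\ :\ [\phi](t,F(t))=P[\phi(s,F(s))](t)\ \text{ for all }t\in\mathbb D\big\}.$$ The interpolant $[\phi^*]$ and the family $\mathcal F(\phi^*)$ are defined in the same way from $\phi^*$, with the roles of $p$ and $q$ exchanged. For a real-differentiable $\psi:\mathbb C^n\to\mathbb R$ let $\frac{\partial\psi}{\partial z}(z)\in\mathbb C^n$ be the vector with coordinates $\frac{\partial\psi}{\partial x_j}-i\frac{\partial\psi}{\partial y_j}$ (where $z_j=x_j+iy_j$),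 i.e. the unique vector with $d\psi_z(v)=\mathrm{Re}\big(\frac{\partial\psi}{\partial z}(z)\cdot v\big)$ for all $v\in\mathbb C^n$. **Statement.** Assume in addition that for every $s\in\partial\mathbb D$ the function $\phi_s$ is (real-)differentiable and strictly convex on $\mathbb C^n$. Then for every $t\in\mathbb D$ the function $[\phi]_t:\mathbb C^n\to\mathbb R$ is differentiable and strictly convex. Moreover, for every $F\in\mathcal F(\phi)$ the function $$G(t)=\frac{\partial[\phi]}{\partial z}(t,F(t))\qquad(t\in\mathbb D)$$ is holomorphic, belongs to $\mathcal F(\phi^*)$, and satisfies $$[\phi](t,F(t))+[\phi^*](t,G(t))=\mathrm{Re}\big(F(t)\cdot G(t)\big)\qquad(t\in\mathbb D).$$ -/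

import Mathlib

open MeasureTheory

namespace DualFoliation

noncomputable section

/-- The boundary `∂𝔻` of the unit disk. -/
abbrev UnitCircle : Type := Metric.sphere (0 : ℂ) 1

/-- The open unit disk `𝔻`. -/
abbrev unitDisk : Set ℂ := Metric.ball (0 : ℂ) 1

/-- The space `ℂⁿ` with its Hermitian norm. -/
abbrev Cn (n : ℕ) : Type := EuclideanSpace ℂ (Fin n)

/-- The complex bilinear pairing `z · w = ∑ zⱼ wⱼ` (no conjugation). -/
def dotC {n : ℕ} (z w : Cn n) : ℂ := ∑ j, z j * w j

/-- The point `e^{iθ}` of the unit circle. -/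
def circlePoint (θ : ℝ) : UnitCircle := ⟨circleMap 0 1 θ, by simp⟩

/-- The normalized arc length measure `σ` on the unit circle: the image of `dθ / 2π` on
`(0, 2π]` under `θ ↦ e^{iθ}`. -/
def circleMeasure : Measure UnitCircle :=
  (ENNReal.ofReal (2 * Real.pi))⁻¹ •
    Measure.map circlePoint (volume.restrict (Set.Ioc 0 (2 * Real.pi)))

/-- The Poisson extension `P[h](t) = ∫ P(t,s) h(s) dσ(s)`, where
`P(t,s) = (1 - |t|²) / |s - t|²`. -/
def poissonExt {X : Type*} [NormedAddCommGroup X] [NormedSpace ℝ X]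
    (h : UnitCircle → X) (t : ℂ) : X :=
  ∫ s, poissonKernel 0 t (s : ℂ) • h s ∂circleMeasure

/-- `F` belongs to the Hardy space `H^r(𝔻, ℂⁿ)` and `f` is its boundary function: `F` is
holomorphic in the disk and is the Poisson extension of `f ∈ L^r(∂𝔻, ℂⁿ)`. The class of `f`
modulo null sets is determined by `F`. -/
structure IsHardy {n : ℕ} (r : ℝ) (F : ℂ → Cn n) (f : UnitCircle → Cn n) : Prop where
  memLp : MemLp f (ENNReal.ofReal r) circleMeasure
  holomorphic : DifferentiableOn ℂ F unitDisk
  eq_poissonExt : ∀ t ∈ unitDisk, F t = poissonExt f t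

/-- The Legendre transform `ψ*(z) = sup_w (Re (z · w) - ψ(w))`. Under the growth conditions
below the supremum is finite. -/
def legendre {n : ℕ} (ψ : Cn n → ℝ) (z : Cn n) : ℝ :=
  ⨆ w : Cn n, ((dotC z w).re - ψ w)

/-- `p`-uniform growth conditions, for finite `p`. -/
def UniformGrowth {n : ℕ} (p : ℝ) (φ : UnitCircle → Cn n → ℝ) : Prop :=
  ∃ c C A : ℝ, 0 < c ∧ 0 < C ∧ 0 < A ∧
    ∀ s w, c * ‖w‖ ^ p - A ≤ φ s w ∧ φ s w ≤ C * ‖w‖ ^ p + A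

/-- The interpolant `[φ](t,w)` of boundary data `φ` with `p`-uniform growth: the supremum of
`L_{f₀,f}(t,w) = Re (f(t) · w) - P[Re f₀](t)` over all pairs `f₀ ∈ L¹(∂𝔻)`, `f ∈ H^q(𝔻, ℂⁿ)`
(`q = p / (p - 1)`) with `φ*_s(f(s)) ≤ Re f₀(s)` for almost every `s`. In the code `F` is the
holomorphic function and `f` its boundary function. Under the growth conditions the set below
is nonempty and bounded above. -/
def interpolant {n : ℕ} (p : ℝ) (φ : UnitCircle → Cn n → ℝ) (t : ℂ) (w : Cn n) : ℝ :=
  sSup {x : ℝ | ∃ (f₀ : UnitCircle → ℂ) (F : ℂ → Cn n) (f : UnitCircle → Cn n),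
    MemLp f₀ 1 circleMeasure ∧ IsHardy (p / (p - 1)) F f ∧
    (∀ᵐ s ∂circleMeasure, legendre (φ s) (f s) ≤ (f₀ s).re) ∧
    x = (dotC (F t) w).re - poissonExt (fun s => (f₀ s).re) t}

/-- The family `𝓕(φ)` of leaves: the holomorphic functions `F ∈ H^p(𝔻, ℂⁿ)` such that
`[φ](t, F(t)) = P[φ(s, F(s))](t)` for all `t` in the disk. -/
def foliation {n : ℕ} (p : ℝ) (φ : UnitCircle → Cn n → ℝ) : Set (ℂ → Cn n) :=
  {F | ∃ f : UnitCircle → Cn n, IsHardy p F f ∧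
    ∀ t ∈ unitDisk, interpolant p φ t (F t) = poissonExt (fun s => φ s (f s)) t}

/-- The complex gradient `∂ψ/∂z`, normalized so that its `j`-th coordinate is
`∂ψ/∂xⱼ - i ∂ψ/∂yⱼ`; equivalently `dψ(z) v = Re (∂ψ/∂z · v)` for all `v`. -/
def complexGradient {n : ℕ} (ψ : Cn n → ℝ) (z : Cn n) : Cn n :=
  WithLp.toLp 2 fun j =>
    ((fderiv ℝ ψ z (EuclideanSpace.single j 1) : ℝ) : ℂ) -
      Complex.I * ((fderiv ℝ ψ z (EuclideanSpace.single j Complex.I) : ℝ) : ℂ)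

end

end DualFoliation

namespace DualFoliation

/-! Write `g s` for the gradient of `φ s` at the boundary value `f s` of a leaf. Fenchel's equality
says `φ s (f s) + legendre (φ s) (g s) = Re (f s · g s)` on the circle. If `g` is the boundary
function of some `G ∈ H^q`, the Poisson extension carries this identity into the disk, because it is
multiplicative on Hardy functions with conjugate exponents (`poissonExt_mul`). Weak duality bounds
`[φ](t, F t)` by the Poisson integral of `φ s (f s)`, and the competitor built from `G` attains the
bound (`interpolant_eq_poissonExt`). Exchanging the roles of `F` and `G` gives the same for the
conjugate data, and the two values add up to `Re (F · G)`.

So the point is that `g` is holomorphic and that its extension is the gradient of the interpolant.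
For a polynomial `P`, the function `x ↦ P[φ(s, f(s) + P(s)x)](t) - [φ](t, F(t) + P(t)x)` is
nonnegative by weak duality and vanishes at `x = 0` on a leaf. Hence its derivative at `0` is zero,
which says that `P · g` has Poisson extension `P(t) ∂[φ]_t(F(t))` at `t`
(`poissonExt_polynomial_smul_complexGradient`). The choice `P = 1` identifies the gradient; `P =
X^(k+1)` at `t = 0` kills the moments of `g` that obstruct holomorphy.

This needs `[φ]_t` to be differentiable. Through any `(t, w)` there is a Hardy function realizing
`[φ](t, w)` as a Poisson integral (`exists_leaf`): minimize that integral among Hardy functions with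
value `w` at `t`. The Euler-Lagrange equation makes the gradient along the minimizer a Hardy
function, so duality applies. Strict convexity of `[φ]_t` follows by combining two such functions,
and differentiability because the convex `[φ]_t` is touched from above by a differentiable function.
The minimizer exists without weak compactness: strict convexity forces minimizing sequences to be
Cauchy in `L¹` (`exists_integral_minimizer`). -/

/-! ### The circle measure and the Poisson kernel. -/

lemma continuous_circlePoint : Continuous circlePoint := by
  unfold circlePoint
  exact Continuous.subtype_mk (continuous_circleMap 0 1) _

lemma norm_coe_unitCircle (s : UnitCircle) : ‖(s : ℂ)‖ = 1 := by
  simp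

lemma coe_unitCircle_ne_zero (s : UnitCircle) : (s : ℂ) ≠ 0 := by
  intro h
  have := norm_coe_unitCircle s
  simp [h] at this

lemma coe_mul_conj (s : UnitCircle) : (s : ℂ) * (starRingEnd ℂ) (s : ℂ) = 1 := by
  rw [Complex.mul_conj, Complex.normSq_eq_norm_sq, norm_coe_unitCircle]; simp

instance : IsProbabilityMeasure circleMeasure := by
  constructor
  have hpi : (0 : ℝ) < 2 * Real.pi := by positivity
  rw [circleMeasure, Measure.smul_apply, Measure.map_apply continuous_circlePoint.measurable
    MeasurableSet.univ]
  simp only [Set.preimage_univ, Measure.restrict_apply_univ, Real.volume_Ioc, sub_zero, smul_eq_mul]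
  exact ENNReal.inv_mul_cancel (by simpa using hpi) ENNReal.ofReal_ne_top

lemma integral_circleMeasure_eq_circleAverage {E : Type*} [NormedAddCommGroup E] [NormedSpace ℝ E]
    (g : ℂ → E) (hg : ContinuousOn g (Metric.sphere (0 : ℂ) 1)) :
    ∫ s : UnitCircle, g s ∂circleMeasure = Real.circleAverage g 0 1 := by
  have hpi : (0 : ℝ) ≤ 2 * Real.pi := by positivity
  have hc : Continuous (fun s : UnitCircle => g s) := by
    exact continuousOn_iff_continuous_domRestrict.mp hg
  rw [circleMeasure, integral_smul_measure, integral_map continuous_circlePoint.aemeasurable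
    hc.aestronglyMeasurable, Real.circleAverage_def, intervalIntegral.integral_of_le hpi]
  simp [circlePoint, ENNReal.toReal_ofReal Real.pi_pos.le]

lemma poissonExt_of_diffContOnCl {E : Type*} [NormedAddCommGroup E] [NormedSpace ℂ E]
    [CompleteSpace E] {u : ℂ → E} (hu : DiffContOnCl ℂ u unitDisk) {t : ℂ} (ht : t ∈ unitDisk) :
    poissonExt (fun s => u s) t = u t := by
  rw [← hu.circleAverage_poissonKernel_smul ht, poissonExt,
    ← integral_circleMeasure_eq_circleAverage]
  · rfl
  · refine ContinuousOn.smul ?_ ?_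
    · rw [poissonKernel_eq_re_herglotzRieszKernel]
      refine Complex.continuous_re.comp_continuousOn ?_
      simpa using continuousOn_herglotzRieszKernel_sphere ht
    · refine hu.2.mono ?_
      rw [closure_ball _ one_ne_zero]
      exact Metric.sphere_subset_closedBall

lemma sub_ne_zero_of_mem_unitDisk {t : ℂ} (ht : t ∈ unitDisk) (s : UnitCircle) :
    (s : ℂ) - t ≠ 0 := by
  intro h
  have h1 := norm_coe_unitCircle s
  rw [sub_eq_zero.mp h] at h1
  simp [h1] at ht

lemma one_sub_conj_mul_ne_zero {t : ℂ} (ht : t ∈ unitDisk) (s : UnitCircle) :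
    1 - (starRingEnd ℂ) t * s ≠ 0 := by
  intro h
  have h2 : ‖(starRingEnd ℂ) t * (s : ℂ)‖ = 1 := by
    rw [← sub_eq_zero.mp h]; simp
  rw [norm_mul, norm_coe_unitCircle, RCLike.norm_conj] at h2
  simp at ht h2
  linarith

lemma poissonKernel_coe (t : ℂ) (s : UnitCircle) :
    poissonKernel 0 t (s : ℂ) = (1 - ‖t‖ ^ 2) / ‖(s : ℂ) - t‖ ^ 2 := by
  simp [poissonKernel_def]

/-- On the circle `conj s = 1/s`, so `|s - t|² = (s - t)(1 - t̄ s)/s`. The factor `s - t` cancels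
the Cauchy pole, and what is left expands in positive powers of `s` only. -/
lemma poissonKernel_mul_sub {t : ℂ} (ht : t ∈ unitDisk) (s : UnitCircle) :
    (poissonKernel 0 t (s : ℂ) : ℂ) * (s - t)
      = (1 - ‖t‖ ^ 2) * (s / (1 - (starRingEnd ℂ) t * s)) := by
  have h1 := sub_ne_zero_of_mem_unitDisk ht s
  have h2 := one_sub_conj_mul_ne_zero ht s
  have h0 := coe_unitCircle_ne_zero s
  have h3 := coe_mul_conj s
  have hn : ((‖(s : ℂ) - t‖ : ℂ)) ^ 2 = (s - t) * ((1 - (starRingEnd ℂ) t * s) / s) := by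
    rw [← Complex.mul_conj']
    congr 1
    rw [eq_div_iff h0, map_sub, sub_mul, mul_comm _ (s : ℂ), h3]
  rw [poissonKernel_coe]
  push_cast
  rw [hn]
  field_simp

/-- Splits the kernel into the Cauchy kernel, holomorphic in `t`, and a part antiholomorphic in `t`
that vanishing moments annihilate. -/
lemma poissonKernel_eq_add {t : ℂ} (ht : t ∈ unitDisk) (s : UnitCircle) :
    (poissonKernel 0 t (s : ℂ) : ℂ)
      = s / (s - t) + (starRingEnd ℂ) t * (s / (1 - (starRingEnd ℂ) t * s)) := by
  have h1 := sub_ne_zero_of_mem_unitDisk ht s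
  have h2 := one_sub_conj_mul_ne_zero ht s
  have h := poissonKernel_mul_sub ht s
  rw [← eq_div_iff h1] at h
  rw [h, ← Complex.mul_conj' t]
  field_simp
  ring

lemma continuous_poissonKernel {t : ℂ} (ht : t ∈ unitDisk) :
    Continuous (fun s : UnitCircle => poissonKernel 0 t (s : ℂ)) := by
  simp only [poissonKernel_coe]
  refine Continuous.div (by fun_prop) (by fun_prop) fun s => ?_
  have := sub_ne_zero_of_mem_unitDisk ht s
  positivity

lemma poissonKernel_le {t : ℂ} (ht : t ∈ unitDisk) (s : UnitCircle) :
    poissonKernel 0 t (s : ℂ) ≤ (1 + ‖t‖) / (1 - ‖t‖) := by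
  simpa [poissonKernel_eq_re_herglotzRieszKernel, herglotzRieszKernel_def] using
    re_herglotzRieszKernel_le s.2 ht

lemma le_poissonKernel {t : ℂ} (ht : t ∈ unitDisk) (s : UnitCircle) :
    (1 - ‖t‖) / (1 + ‖t‖) ≤ poissonKernel 0 t (s : ℂ) := by
  simpa [poissonKernel_eq_re_herglotzRieszKernel, herglotzRieszKernel_def] using
    le_re_herglotzRieszKernel s.2 ht

lemma poissonLower_pos {t : ℂ} (ht : t ∈ unitDisk) : 0 < (1 - ‖t‖) / (1 + ‖t‖) := by
  have : ‖t‖ < 1 := by simpa using ht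
  have := norm_nonneg t
  exact div_pos (by linarith) (by linarith)

lemma poissonKernel_pos {t : ℂ} (ht : t ∈ unitDisk) (s : UnitCircle) :
    0 < poissonKernel 0 t (s : ℂ) :=
  (poissonLower_pos ht).trans_le (le_poissonKernel ht s)

lemma norm_poissonKernel_le {t : ℂ} (ht : t ∈ unitDisk) (s : UnitCircle) :
    ‖poissonKernel 0 t (s : ℂ)‖ ≤ (1 + ‖t‖) / (1 - ‖t‖) := by
  rw [Real.norm_of_nonneg (poissonKernel_pos ht s).le]
  exact poissonKernel_le ht s

lemma Integrable.poissonKernel_smul {E : Type*} [NormedAddCommGroup E] [NormedSpace ℝ E]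
    {h : UnitCircle → E} (hh : Integrable h circleMeasure) {t : ℂ} (ht : t ∈ unitDisk) :
    Integrable (fun s : UnitCircle => poissonKernel 0 t (s : ℂ) • h s) circleMeasure :=
  hh.bdd_smul _ (continuous_poissonKernel ht).aestronglyMeasurable
    (Filter.Eventually.of_forall (norm_poissonKernel_le ht))

/-- For unimodular `s`, `u` one has `u - r s = u s · conj (s - r u)`. After Fubini this lets a
dilation pass from one factor to the other. -/
lemma poissonKernel_symm (r : ℝ) (s u : UnitCircle) :
    poissonKernel 0 ((r : ℂ) * s) (u : ℂ) = poissonKernel 0 ((r : ℂ) * u) (s : ℂ) := by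
  rw [poissonKernel_coe, poissonKernel_coe]
  simp only [norm_mul, norm_coe_unitCircle]
  congr 2
  have h : (u : ℂ) - r * s = u * s * (starRingEnd ℂ) (s - r * u) := by
    have h1 := coe_mul_conj s
    have h2 := coe_mul_conj u
    simp only [map_sub, map_mul, Complex.conj_ofReal]
    linear_combination (-(u : ℂ)) * h1 + (r * s : ℂ) * h2
  rw [h, norm_mul, norm_mul, RCLike.norm_conj, norm_coe_unitCircle, norm_coe_unitCircle]
  ring

lemma mul_coe_mem_unitDisk {r : ℝ} (h0 : 0 ≤ r) (h1 : r < 1) (s : UnitCircle) :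
    (r : ℂ) * s ∈ unitDisk := by
  simp [abs_of_nonneg h0, h1]

lemma poissonExt_const {E : Type*} [NormedAddCommGroup E] [NormedSpace ℂ E]
    [CompleteSpace E] (c : E) {t : ℂ} (ht : t ∈ unitDisk) :
    poissonExt (fun _ => c) t = c :=
  poissonExt_of_diffContOnCl (u := fun _ => c) diffContOnCl_const ht

lemma integral_poissonKernel {t : ℂ} (ht : t ∈ unitDisk) :
    ∫ s : UnitCircle, poissonKernel 0 t (s : ℂ) ∂circleMeasure = 1 := by
  have h := poissonExt_const (1 : ℂ) ht
  rw [poissonExt] at h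
  simp only [Complex.real_smul, mul_one] at h
  rw [integral_complex_ofReal] at h
  exact_mod_cast h

/-! ### Holomorphy of a Poisson extension in terms of moments. -/

/-- The moments `∫ s^k f dσ`, `k ≥ 1`, vanish: `f` is the boundary function of a holomorphic
function. -/
def MomentsVanish (f : UnitCircle → ℂ) : Prop :=
  ∀ k : ℕ, ∫ s : UnitCircle, (s : ℂ) ^ (k + 1) * f s ∂circleMeasure = 0

lemma Integrable.continuous_mul {f m : UnitCircle → ℂ} (hf : Integrable f circleMeasure)
    (hm : Continuous m) : Integrable (fun s => m s * f s) circleMeasure := by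
  obtain ⟨C, hC⟩ := (isCompact_range hm).isBounded.exists_norm_le
  exact hf.bdd_mul hm.aestronglyMeasurable
    (Filter.Eventually.of_forall fun s => hC _ ⟨s, rfl⟩)

lemma hasSum_integral_geometric {f v : UnitCircle → ℂ} (hf : Integrable f circleMeasure)
    (hv : Continuous v) {r : ℝ} (hr : r < 1) (hvr : ∀ s, ‖v s‖ ≤ r) :
    HasSum (fun k : ℕ => ∫ s, v s ^ k * f s ∂circleMeasure)
      (∫ s, (1 - v s)⁻¹ * f s ∂circleMeasure) := by
  have hr0 : 0 ≤ r := (norm_nonneg _).trans (hvr (circlePoint 0))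
  have hle : ∀ k s, ‖v s ^ k * f s‖ ≤ r ^ k * ‖f s‖ := fun k s => by
    rw [norm_mul, norm_pow]
    gcongr
    exact hvr s
  have hint : ∀ k, Integrable (fun s => v s ^ k * f s) circleMeasure := fun k =>
    Integrable.continuous_mul hf (hv.pow k)
  have hsum := hasSum_integral_of_summable_integral_norm hint (by
    refine Summable.of_nonneg_of_le (fun k => integral_nonneg fun s => norm_nonneg _) (fun k => ?_)
      ((summable_geometric_of_lt_one hr0 hr).mul_right (∫ s, ‖f s‖ ∂circleMeasure))
    rw [← integral_const_mul]
    exact integral_mono (hint k).norm (hf.norm.const_mul _) (hle k))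
  have he : ∀ s, ∑' k, v s ^ k * f s = (1 - v s)⁻¹ * f s := fun s => by
      rw [tsum_mul_right, tsum_geometric_of_norm_lt_one ((hvr s).trans_lt hr)]
  simpa only [he] using hsum

/-- The multiplier is `∑ t̄^k s^(k+1)`, and each term integrates to a vanishing moment. -/
lemma MomentsVanish.integral_antiholomorphic_eq_zero {f : UnitCircle → ℂ}
    (hf : Integrable f circleMeasure)
    (hm : MomentsVanish f) {t : ℂ} (ht : t ∈ unitDisk) :
    ∫ s : UnitCircle, (s / (1 - (starRingEnd ℂ) t * s)) * f s ∂circleMeasure = 0 := by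
  have hf' : Integrable (fun s : UnitCircle => (s : ℂ) * f s) circleMeasure :=
    Integrable.continuous_mul hf (by fun_prop)
  have h := hasSum_integral_geometric hf' (v := fun s => (starRingEnd ℂ) t * s) (by fun_prop)
    (r := ‖t‖) (by simpa using ht) (fun s => by simp)
  have h0 : ∀ k : ℕ, ∫ s : UnitCircle, ((starRingEnd ℂ) t * s) ^ k * (s * f s) ∂circleMeasure
      = 0 := fun k => by
    calc _ = ∫ s : UnitCircle, ((starRingEnd ℂ) t) ^ k * (s ^ (k + 1) * f s) ∂circleMeasure := by
          congr 1; ext s; ring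
      _ = 0 := by rw [integral_const_mul, hm k, mul_zero]
  simp only [h0] at h
  refine Eq.trans ?_ (h.unique hasSum_zero)
  congr 1; ext s; ring

lemma integrable_antiholomorphic {f : UnitCircle → ℂ} (hf : Integrable f circleMeasure)
    {t : ℂ} (ht : t ∈ unitDisk) :
    Integrable (fun s : UnitCircle => (s / (1 - (starRingEnd ℂ) t * s)) * f s) circleMeasure :=
  Integrable.continuous_mul hf
    (Continuous.div (by fun_prop) (by fun_prop) (one_sub_conj_mul_ne_zero ht))

lemma MomentsVanish.poissonExt_eq {f : UnitCircle → ℂ} (hf : Integrable f circleMeasure)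
    (hm : MomentsVanish f) {t : ℂ} (ht : t ∈ unitDisk) :
    poissonExt f t = ∫ s : UnitCircle, (s / (s - t)) * f s ∂circleMeasure := by
  have h1 : Integrable (fun s : UnitCircle => ((s : ℂ) / (s - t)) * f s) circleMeasure :=
    Integrable.continuous_mul hf
      (Continuous.div (by fun_prop) (by fun_prop) (sub_ne_zero_of_mem_unitDisk ht))
  have h2 := (integrable_antiholomorphic hf ht).const_mul ((starRingEnd ℂ) t)
  have h3 := integral_add h1 h2
  rw [integral_const_mul, hm.integral_antiholomorphic_eq_zero hf ht, mul_zero, add_zero] at h3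
  rw [← h3, poissonExt]
  congr 1; ext s
  rw [Complex.real_smul, poissonKernel_eq_add ht]
  ring

/-- Only the Cauchy kernel survives, and on the circle it is the geometric series in `t · conj s`.
This power series gives holomorphy. -/
lemma MomentsVanish.hasSum_poissonExt {f : UnitCircle → ℂ} (hf : Integrable f circleMeasure)
    (hm : MomentsVanish f) {t : ℂ} (ht : t ∈ unitDisk) :
    HasSum (fun k : ℕ => t ^ k * ∫ s : UnitCircle, (starRingEnd ℂ) (s : ℂ) ^ k * f s ∂circleMeasure)
      (poissonExt f t) := by
  have h := hasSum_integral_geometric hf (v := fun s => t * (starRingEnd ℂ) (s : ℂ))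
    (by fun_prop) (r := ‖t‖) (by simpa using ht) (fun s => by simp)
  rw [hm.poissonExt_eq hf ht]
  convert h using 2 with k
  · rw [← integral_const_mul]
    congr 1; ext s; ring
  · ext s
    congr 1
    have h1 := sub_ne_zero_of_mem_unitDisk ht s
    rw [div_eq_iff h1, inv_mul_eq_div, eq_div_iff]
    · linear_combination (-t) * coe_mul_conj s
    · intro h
      apply h1
      linear_combination (s : ℂ) * h + t * coe_mul_conj s

lemma norm_moment_le {f : UnitCircle → ℂ} (k : ℕ) :
    ‖∫ s : UnitCircle, (starRingEnd ℂ) (s : ℂ) ^ k * f s ∂circleMeasure‖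
      ≤ ∫ s, ‖f s‖ ∂circleMeasure := by
  refine (norm_integral_le_integral_norm _).trans_eq ?_
  congr 1; ext s; simp

lemma MomentsVanish.differentiableOn {f : UnitCircle → ℂ} (hf : Integrable f circleMeasure)
    (hm : MomentsVanish f) : DifferentiableOn ℂ (poissonExt f) unitDisk := by
  intro t ht
  have ht' : ‖t‖ < 1 := by simpa using ht
  obtain ⟨r, hr, hr1⟩ := exists_between ht'
  have hr0 : 0 ≤ r := (norm_nonneg t).trans hr.le
  have hd : DifferentiableOn ℂ (fun z : ℂ => ∑' k : ℕ, z ^ k *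
      ∫ s : UnitCircle, (starRingEnd ℂ) (s : ℂ) ^ k * f s ∂circleMeasure) (Metric.ball 0 r) := by
    refine Complex.differentiableOn_tsum_of_summable_norm
      ((summable_geometric_of_lt_one hr0 hr1).mul_right (∫ s, ‖f s‖ ∂circleMeasure))
      (fun k => by fun_prop) Metric.isOpen_ball fun k z hz => ?_
    rw [norm_mul, norm_pow]
    gcongr
    · simpa using (mem_ball_zero_iff.mp hz).le
    · exact norm_moment_le k
  have hmem : Metric.ball (0 : ℂ) r ∈ nhds t := Metric.isOpen_ball.mem_nhds (by simpa using hr)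
  refine ((hd.differentiableAt hmem).congr_of_eventuallyEq ?_).differentiableWithinAt
  filter_upwards [hmem] with z hz
  have hz' : z ∈ unitDisk := Metric.ball_subset_ball hr1.le hz
  exact (hm.hasSum_poissonExt hf hz').tsum_eq.symm

lemma MomentsVanish.pow_mul {f : UnitCircle → ℂ} (hm : MomentsVanish f) (k : ℕ) :
    MomentsVanish (fun s => (s : ℂ) ^ k * f s) := fun j => by
  refine Eq.trans ?_ (hm (j + k))
  congr 1; ext s; ring

lemma poissonExt_sub_mul (f : UnitCircle → ℂ) {t : ℂ} (ht : t ∈ unitDisk) :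
    poissonExt (fun s : UnitCircle => ((s : ℂ) - t) * f s) t =
      (1 - ‖t‖ ^ 2) *
        ∫ s : UnitCircle, (s / (1 - (starRingEnd ℂ) t * s)) * f s ∂circleMeasure := by
  rw [poissonExt, ← integral_const_mul]
  congr 1; ext s
  rw [Complex.real_smul, ← mul_assoc, poissonKernel_mul_sub ht]
  ring

/-- Induction on `s^(k+1) = (s - t) s^k + t s^k`: the first summand contributes zero by
`poissonExt_sub_mul`. This is the seed of multiplicativity. -/
lemma MomentsVanish.poissonExt_pow_mul {f : UnitCircle → ℂ} (hf : Integrable f circleMeasure)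
    (hm : MomentsVanish f) {t : ℂ} (ht : t ∈ unitDisk) (k : ℕ) :
    poissonExt (fun s => (s : ℂ) ^ k * f s) t = t ^ k * poissonExt f t := by
  induction k with
  | zero => simp
  | succ k ih =>
    have hfk : Integrable (fun s : UnitCircle => (s : ℂ) ^ k * f s) circleMeasure :=
      Integrable.continuous_mul hf (by fun_prop)
    have h1 := poissonExt_sub_mul (fun s : UnitCircle => (s : ℂ) ^ k * f s) ht
    rw [(hm.pow_mul k).integral_antiholomorphic_eq_zero hfk ht, mul_zero] at h1
    have hi1 : Integrable (fun s : UnitCircle => ((s : ℂ) - t) * ((s : ℂ) ^ k * f s))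
        circleMeasure := Integrable.continuous_mul hfk (by fun_prop)
    have h2 : poissonExt (fun s => (s : ℂ) ^ (k + 1) * f s) t
        = poissonExt (fun s : UnitCircle => ((s : ℂ) - t) * ((s : ℂ) ^ k * f s)) t
          + t * poissonExt (fun s => (s : ℂ) ^ k * f s) t := by
      simp only [poissonExt]
      rw [← integral_const_mul, ← integral_add (Integrable.poissonKernel_smul hi1 ht)
        ((Integrable.poissonKernel_smul hfk ht).const_mul t)]
      congr 1; ext s
      simp only [Complex.real_smul]
      ring
    rw [h2, h1, ih]
    ring

/-- Serves the Euler-Lagrange equation at `t`, where only test polynomials vanishing at `t` are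
available. With `K = s / (1 - t̄ s)` one has `s = K - t̄ s K`, so each moment is a combination of
two integrals known to vanish. -/
lemma momentsVanish_of_poissonExt_eq_zero {f : UnitCircle → ℂ}
    (hf : Integrable f circleMeasure) {t : ℂ} (ht : t ∈ unitDisk)
    (h : ∀ k : ℕ, poissonExt (fun s : UnitCircle => ((s : ℂ) - t) * ((s : ℂ) ^ k * f s)) t = 0) :
    MomentsVanish f := by
  have ht' : (1 - (‖t‖ : ℂ) ^ 2) ≠ 0 := by
    have : ‖t‖ < 1 := by simpa using ht
    have h2 : (1 - ‖t‖ ^ 2 : ℝ) ≠ 0 := by nlinarith [norm_nonneg t]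
    exact_mod_cast h2
  have h' : ∀ k : ℕ, ∫ s : UnitCircle,
      (s / (1 - (starRingEnd ℂ) t * s)) * ((s : ℂ) ^ k * f s) ∂circleMeasure = 0 := fun k => by
    have := h k
    rw [poissonExt_sub_mul _ ht] at this
    exact (mul_eq_zero.mp this).resolve_left ht'
  have hfk : ∀ k : ℕ, Integrable (fun s : UnitCircle => (s : ℂ) ^ k * f s) circleMeasure :=
    fun k => Integrable.continuous_mul hf (by fun_prop)
  intro k
  have h3 := integral_sub (integrable_antiholomorphic (hfk k) ht)
    ((integrable_antiholomorphic (hfk (k + 1)) ht).const_mul ((starRingEnd ℂ) t))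
  rw [integral_const_mul, h' k, h' (k + 1), mul_zero, sub_zero] at h3
  refine Eq.trans ?_ h3
  congr 1; ext s
  have h4 := div_mul_cancel₀ (s : ℂ) (one_sub_conj_mul_ne_zero ht s)
  linear_combination (-((s : ℂ) ^ k * f s)) * h4

lemma continuous_dilated_poissonKernel {r : ℝ} (h0 : 0 ≤ r) (h1 : r < 1) :
    Continuous (fun x : UnitCircle × UnitCircle => poissonKernel 0 ((r : ℂ) * x.1) (x.2 : ℂ)) := by
  simp only [poissonKernel_coe]
  refine Continuous.div (by fun_prop) (by fun_prop) fun x => ?_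
  have := sub_ne_zero_of_mem_unitDisk (mul_coe_mem_unitDisk h0 h1 x.1) x.2
  positivity

lemma integrable_dilated_prod {f : UnitCircle → ℂ} (hf : Integrable f circleMeasure)
    {m : UnitCircle → ℂ} (hm : Continuous m) {r : ℝ} (h0 : 0 ≤ r) (h1 : r < 1) :
    Integrable (fun x : UnitCircle × UnitCircle =>
      m x.1 * (poissonKernel 0 ((r : ℂ) * x.1) (x.2 : ℂ) • f x.2))
      (circleMeasure.prod circleMeasure) := by
  have hc : Continuous (fun x : UnitCircle × UnitCircle =>
      m x.1 * (poissonKernel 0 ((r : ℂ) * x.1) (x.2 : ℂ) : ℂ)) :=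
    (hm.comp continuous_fst).mul (Complex.continuous_ofReal.comp
      (continuous_dilated_poissonKernel h0 h1))
  obtain ⟨C, hC⟩ := (isCompact_range hc).isBounded.exists_norm_le
  have := (hf.comp_snd circleMeasure).bdd_mul hc.aestronglyMeasurable
    (Filter.Eventually.of_forall fun s => hC _ ⟨s, rfl⟩)
  refine this.congr (Filter.Eventually.of_forall fun x => ?_)
  simp only [Complex.real_smul]
  ring

/-- The mean value property at `0` kills `∫ s^(k+1) P[f](s/2)`. By Fubini and the symmetry of the
kernel this integral is `(1/2)^(k+1)` times the moment of `f`. Any radius strictly between `0` and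
`1` would do. -/
lemma momentsVanish_of_differentiableOn {f : UnitCircle → ℂ} (hf : Integrable f circleMeasure)
    (hd : DifferentiableOn ℂ (poissonExt f) unitDisk) : MomentsVanish f := by
  intro k
  have h0 : (0 : ℝ) ≤ 1 / 2 := by norm_num
  have h1 : (1 / 2 : ℝ) < 1 := by norm_num
  have hz : DiffContOnCl ℂ (fun z : ℂ => z ^ (k + 1) * poissonExt f (((1 / 2 : ℝ) : ℂ) * z))
      unitDisk := by
    refine DifferentiableOn.diffContOnCl ?_
    rw [closure_ball _ one_ne_zero]
    refine DifferentiableOn.mul (by fun_prop) (hd.comp (by fun_prop) fun z hz => ?_)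
    simp at hz ⊢
    linarith
  have hA : ∫ s : UnitCircle, (s : ℂ) ^ (k + 1) * poissonExt f (((1 / 2 : ℝ) : ℂ) * s)
      ∂circleMeasure = 0 := by
    have := poissonExt_of_diffContOnCl hz (t := 0) (by simp)
    simpa [poissonExt, poissonKernel_coe] using this
  have hB : ∫ s : UnitCircle, (s : ℂ) ^ (k + 1) * poissonExt f (((1 / 2 : ℝ) : ℂ) * s)
      ∂circleMeasure = ((1 / 2 : ℝ) : ℂ) ^ (k + 1) *
        ∫ u : UnitCircle, (u : ℂ) ^ (k + 1) * f u ∂circleMeasure := by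
    have hI := integrable_dilated_prod hf (m := fun s => (s : ℂ) ^ (k + 1)) (by fun_prop) h0 h1
    calc _ = ∫ s : UnitCircle, ∫ u : UnitCircle, (s : ℂ) ^ (k + 1) *
          (poissonKernel 0 (((1 / 2 : ℝ) : ℂ) * s) (u : ℂ) • f u) ∂circleMeasure ∂circleMeasure := by
          simp only [poissonExt, integral_const_mul]
      _ = _ := integral_integral_swap hI
      _ = _ := by
          rw [← integral_const_mul]
          congr 1; ext u
          have hp := poissonExt_of_diffContOnCl (u := fun z : ℂ => z ^ (k + 1))
            (Differentiable.diffContOnCl (by fun_prop)) (mul_coe_mem_unitDisk h0 h1 u)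
          rw [← mul_assoc, ← mul_pow, ← hp, poissonExt, ← integral_mul_const]
          congr 1; ext s
          rw [poissonKernel_symm]
          simp only [Complex.real_smul]
          ring
  rw [hA] at hB
  have := mul_eq_zero.mp hB.symm
  refine this.resolve_left ?_
  simp

/-! ### Convergence of dilates in `L^p` and multiplicativity of the Poisson extension. -/

/-- The dilate `s ↦ P[f](r s)` of the Poisson extension of `f`. -/
noncomputable def dilate (f : UnitCircle → ℂ) (r : ℝ) (s : UnitCircle) : ℂ :=
  poissonExt f ((r : ℂ) * s)

lemma aestronglyMeasurable_dilate {f : UnitCircle → ℂ} (hf : Integrable f circleMeasure)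
    {r : ℝ} (h0 : 0 ≤ r) (h1 : r < 1) : AEStronglyMeasurable (dilate f r) circleMeasure := by
  have h := (integrable_dilated_prod hf (m := fun _ => 1) continuous_const h0 h1).1
  have h2 := h.integral_prod_right'
  simp only [one_mul] at h2
  exact h2

lemma lintegral_poissonKernel {t : ℂ} (ht : t ∈ unitDisk) :
    ∫⁻ s : UnitCircle, ENNReal.ofReal (poissonKernel 0 t (s : ℂ)) ∂circleMeasure = 1 := by
  have hi : Integrable (fun s : UnitCircle => poissonKernel 0 t (s : ℂ)) circleMeasure := by
    simpa using Integrable.poissonKernel_smul (integrable_const (1 : ℝ)) ht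
  rw [← ofReal_integral_eq_lintegral_ofReal hi
    (Filter.Eventually.of_forall fun s => (poissonKernel_pos ht s).le), integral_poissonKernel ht,
    ENNReal.ofReal_one]

/-- Jensen's inequality for the probability measure with the Poisson kernel as density, in the form
that the `L¹` norm is at most the `L^p` norm. -/
lemma enorm_poissonExt_rpow_le {f : UnitCircle → ℂ} (hf : AEStronglyMeasurable f circleMeasure)
    {p : ENNReal} (hp1 : 1 ≤ p) (hp : p ≠ ⊤) {t : ℂ} (ht : t ∈ unitDisk) :
    ‖poissonExt f t‖ₑ ^ p.toReal ≤
      ∫⁻ s : UnitCircle, ENNReal.ofReal (poissonKernel 0 t (s : ℂ)) * ‖f s‖ₑ ^ p.toReal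
        ∂circleMeasure := by
  have hp0 : p ≠ 0 := (zero_lt_one.trans_le hp1).ne'
  have hppos : 0 < p.toReal := ENNReal.toReal_pos hp0 hp
  have hw : Measurable (fun s : UnitCircle => ENNReal.ofReal (poissonKernel 0 t (s : ℂ))) :=
    (continuous_poissonKernel ht).measurable.ennreal_ofReal
  set ν := circleMeasure.withDensity
    (fun s : UnitCircle => ENNReal.ofReal (poissonKernel 0 t (s : ℂ))) with hν
  have : IsProbabilityMeasure ν := ⟨by
    rw [hν, withDensity_apply _ MeasurableSet.univ, Measure.restrict_univ,
      lintegral_poissonKernel ht]⟩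
  have hfν : AEStronglyMeasurable f ν := hf.mono_ac (withDensity_absolutelyContinuous _ _)
  have h1 : ‖poissonExt f t‖ₑ ≤ eLpNorm f 1 ν := by
    rw [eLpNorm_one_eq_lintegral_enorm, hν,
      lintegral_withDensity_eq_lintegral_mul₀ hw.aemeasurable hf.enorm]
    refine (enorm_integral_le_lintegral_enorm _).trans_eq ?_
    congr 1; ext s
    rw [enorm_smul, Real.enorm_of_nonneg (poissonKernel_pos ht s).le]
    rfl
  have h2 := h1.trans (eLpNorm_le_eLpNorm_of_exponent_le hp1 hfν)
  calc _ ≤ eLpNorm f p ν ^ p.toReal := by gcongr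
    _ = ∫⁻ s, ‖f s‖ₑ ^ p.toReal ∂ν := by
      rw [eLpNorm_eq_lintegral_rpow_enorm_toReal hp0 hp, ← ENNReal.rpow_mul,
        one_div_mul_cancel hppos.ne', ENNReal.rpow_one]
    _ = _ := by
      rw [hν, lintegral_withDensity_eq_lintegral_mul₀ hw.aemeasurable (hf.enorm.pow_const _)]
      rfl

/-- By `poissonKernel_symm` the kernel also has total mass one in the variable `s`, so integrating
the pointwise bound loses nothing. -/
lemma eLpNorm_dilate_le {f : UnitCircle → ℂ} (hf : AEStronglyMeasurable f circleMeasure)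
    {p : ENNReal} (hp1 : 1 ≤ p) (hp : p ≠ ⊤) {r : ℝ} (h0 : 0 ≤ r) (h1 : r < 1) :
    eLpNorm (dilate f r) p circleMeasure ≤ eLpNorm f p circleMeasure := by
  have hp0 : p ≠ 0 := (zero_lt_one.trans_le hp1).ne'
  have hppos : 0 < p.toReal := ENNReal.toReal_pos hp0 hp
  rw [eLpNorm_eq_lintegral_rpow_enorm_toReal hp0 hp, eLpNorm_eq_lintegral_rpow_enorm_toReal hp0 hp]
  refine ENNReal.rpow_le_rpow ?_ (by positivity)
  have hm : AEMeasurable (fun x : UnitCircle × UnitCircle =>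
      ENNReal.ofReal (poissonKernel 0 ((r : ℂ) * x.1) (x.2 : ℂ)) * ‖f x.2‖ₑ ^ p.toReal)
      (circleMeasure.prod circleMeasure) :=
    (continuous_dilated_poissonKernel h0 h1).measurable.ennreal_ofReal.aemeasurable.mul
      ((hf.enorm.pow_const _).comp_snd)
  calc _ ≤ ∫⁻ s : UnitCircle, ∫⁻ u : UnitCircle,
        ENNReal.ofReal (poissonKernel 0 ((r : ℂ) * s) (u : ℂ)) * ‖f u‖ₑ ^ p.toReal
          ∂circleMeasure ∂circleMeasure :=
        lintegral_mono fun s => enorm_poissonExt_rpow_le hf hp1 hp (mul_coe_mem_unitDisk h0 h1 s)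
    _ = _ := lintegral_lintegral_swap hm
    _ = _ := by
        congr 1; ext u
        have hu : Measurable (fun s : UnitCircle =>
            ENNReal.ofReal (poissonKernel 0 ((r : ℂ) * s) (u : ℂ))) :=
          ((continuous_dilated_poissonKernel h0 h1).comp
            (Continuous.prodMk_left u)).measurable.ennreal_ofReal
        rw [lintegral_mul_const _ hu]
        simp_rw [poissonKernel_symm r _ u]
        rw [lintegral_poissonKernel (mul_coe_mem_unitDisk h0 h1 u), one_mul]

/-- On the circle `|u - s|² = Re (2 - 2 s̄ u)`, the real part of a holomorphic function of `u`. Its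
smallness as `r → 1` measures how the kernel concentrates at `s`. -/
lemma poissonExt_norm_sub_sq {r : ℝ} (h0 : 0 ≤ r) (h1 : r < 1) (s : UnitCircle) :
    poissonExt (fun u : UnitCircle => ‖(u : ℂ) - s‖ ^ 2) ((r : ℂ) * s) = 2 - 2 * r := by
  have ht := mul_coe_mem_unitDisk h0 h1 s
  have hp := poissonExt_of_diffContOnCl (u := fun z : ℂ => 2 - 2 * ((starRingEnd ℂ) (s : ℂ) * z))
    (Differentiable.diffContOnCl (by fun_prop)) ht
  have hi : Integrable (fun u : UnitCircle => poissonKernel 0 ((r : ℂ) * s) (u : ℂ) •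
      (2 - 2 * ((starRingEnd ℂ) (s : ℂ) * (u : ℂ)))) circleMeasure := by
    refine Integrable.poissonKernel_smul ?_ ht
    simpa using Integrable.continuous_mul (integrable_const (1 : ℂ))
      (m := fun u : UnitCircle => 2 - 2 * ((starRingEnd ℂ) (s : ℂ) * (u : ℂ))) (by fun_prop)
  have h2 := congrArg Complex.re hp
  rw [poissonExt, ← RCLike.re_eq_complex_re, ← integral_re hi] at h2
  have h3 : (RCLike.re (2 - 2 * ((starRingEnd ℂ) (s : ℂ) * ((r : ℂ) * s))) : ℝ) = 2 - 2 * r := by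
    have : (2 - 2 * ((starRingEnd ℂ) (s : ℂ) * ((r : ℂ) * s))) = ((2 - 2 * r : ℝ) : ℂ) := by
      push_cast
      linear_combination (-2 * r : ℂ) * coe_mul_conj s
    rw [this]
    simp
  rw [h3] at h2
  rw [← h2, poissonExt]
  congr 1; ext u
  rw [Complex.real_smul, RCLike.re_eq_complex_re, Complex.re_ofReal_mul, smul_eq_mul]
  congr 1
  rw [← Complex.normSq_eq_norm_sq, Complex.normSq_sub, Complex.normSq_eq_norm_sq,
    Complex.normSq_eq_norm_sq, norm_coe_unitCircle, norm_coe_unitCircle]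
  simp
  ring

/-- Chebyshev's argument: uniform continuity handles `u` near `s`, and elsewhere `2M ≤ (2M/δ²)|u -
s|²`, whose Poisson integral tends to zero uniformly in `s`. -/
lemma eventually_norm_dilate_sub_le {h : UnitCircle → ℂ} (hc : Continuous h) {ε : ℝ}
    (hε : 0 < ε) : ∀ᶠ r in nhdsWithin (1 : ℝ) (Set.Iio 1), ∀ s, ‖dilate h r s - h s‖ ≤ ε := by
  obtain ⟨M, hM⟩ := (isCompact_range hc).isBounded.exists_norm_le
  have hM' : ∀ s, ‖h s‖ ≤ M := fun s => hM _ ⟨s, rfl⟩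
  have hM0 : 0 ≤ M := (norm_nonneg _).trans (hM' (circlePoint 0))
  obtain ⟨δ, hδ, hδ'⟩ := Metric.uniformContinuous_iff.mp
    (CompactSpace.uniformContinuous_of_continuous hc) (ε / 2) (by positivity)
  have hlim : Filter.Tendsto (fun r : ℝ => ε / 2 + 2 * M / δ ^ 2 * (2 - 2 * r))
      (nhdsWithin (1 : ℝ) (Set.Iio 1)) (nhds (ε / 2 + 2 * M / δ ^ 2 * (2 - 2 * 1))) := by
    refine Filter.Tendsto.mono_left ?_ nhdsWithin_le_nhds
    exact Continuous.tendsto (by fun_prop) 1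
  have hlt : ε / 2 + 2 * M / δ ^ 2 * (2 - 2 * 1) < ε := by
    rw [mul_one, sub_self, mul_zero, add_zero]
    linarith
  have hev := hlim.eventually (gt_mem_nhds hlt)
  filter_upwards [hev, self_mem_nhdsWithin,
    nhdsWithin_le_nhds (lt_mem_nhds (zero_lt_one (α := ℝ)))] with r hr hr1 hr0 s
  have h0 : 0 ≤ r := le_of_lt hr0
  have h1 : r < 1 := hr1
  have ht := mul_coe_mem_unitDisk h0 h1 s
  have hint : ∀ {g : UnitCircle → ℝ}, Continuous g → Integrable g circleMeasure := fun hg =>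
    hg.integrable_of_hasCompactSupport (HasCompactSupport.of_compactSpace _)
  have hhint : Integrable h circleMeasure :=
    hc.integrable_of_hasCompactSupport (HasCompactSupport.of_compactSpace _)
  have e1 : dilate h r s - h s = poissonExt (fun u => h u - h s) ((r : ℂ) * s) := by
    conv_lhs => rw [dilate, ← poissonExt_const (h s) ht]
    simp only [poissonExt]
    rw [← integral_sub (Integrable.poissonKernel_smul hhint ht)
      (Integrable.poissonKernel_smul (integrable_const _) ht)]
    simp only [smul_sub]
  rw [e1]
  have hb : ∀ u, ‖h u - h s‖ ≤ ε / 2 + 2 * M / δ ^ 2 * ‖(u : ℂ) - s‖ ^ 2 := fun u => by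
    rcases lt_or_ge (dist u s) δ with hd | hd
    · have := hδ' hd
      rw [dist_eq_norm] at this
      have : 0 ≤ 2 * M / δ ^ 2 * ‖(u : ℂ) - s‖ ^ 2 := by positivity
      linarith
    · rw [Subtype.dist_eq, dist_eq_norm] at hd
      have h3 : ‖h u - h s‖ ≤ 2 * M := by
        have := norm_sub_le (h u) (h s)
        linarith [hM' u, hM' s]
      have h4 : 2 * M ≤ 2 * M / δ ^ 2 * ‖(u : ℂ) - s‖ ^ 2 := by
        rw [div_mul_eq_mul_div, le_div_iff₀ (by positivity)]
        gcongr
      linarith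
  have hI1 : Integrable (fun u : UnitCircle => poissonKernel 0 ((r : ℂ) * s) (u : ℂ) • (ε / 2))
      circleMeasure := Integrable.poissonKernel_smul (integrable_const _) ht
  have hI2 : Integrable (fun u : UnitCircle => poissonKernel 0 ((r : ℂ) * s) (u : ℂ) •
      ‖(u : ℂ) - s‖ ^ 2) circleMeasure := Integrable.poissonKernel_smul (hint (by fun_prop)) ht
  calc _ ≤ ∫ u : UnitCircle, (poissonKernel 0 ((r : ℂ) * s) (u : ℂ) • (ε / 2) + 2 * M / δ ^ 2 *
        (poissonKernel 0 ((r : ℂ) * s) (u : ℂ) • ‖(u : ℂ) - s‖ ^ 2)) ∂circleMeasure := by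
        refine norm_integral_le_of_norm_le (hI1.add (hI2.const_mul _))
          (Filter.Eventually.of_forall fun u => ?_)
        rw [norm_smul, Real.norm_of_nonneg (poissonKernel_pos ht u).le]
        have := mul_le_mul_of_nonneg_left (hb u) (poissonKernel_pos ht u).le
        simp only [smul_eq_mul]
        linarith
    _ = ε / 2 + 2 * M / δ ^ 2 * (2 - 2 * r) := by
        rw [integral_add hI1 (hI2.const_mul _), integral_const_mul, integral_smul_const,
          integral_poissonKernel ht, one_smul]
        congr 2
        exact poissonExt_norm_sub_sq h0 h1 s
    _ ≤ ε := le_of_lt hr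

lemma dilate_sub {f g : UnitCircle → ℂ} (hf : Integrable f circleMeasure)
    (hg : Integrable g circleMeasure) {r : ℝ} (h0 : 0 ≤ r) (h1 : r < 1) :
    dilate (f - g) r = dilate f r - dilate g r := by
  ext s
  have ht := mul_coe_mem_unitDisk h0 h1 s
  simp only [dilate, poissonExt, Pi.sub_apply, smul_sub]
  rw [integral_sub (Integrable.poissonKernel_smul hf ht) (Integrable.poissonKernel_smul hg ht)]

/-- Continuous functions are dense in `L^p` for finite `p`, and dilation is a contraction. -/
lemma tendsto_eLpNorm_dilate_sub {f : UnitCircle → ℂ} {p : ENNReal} (hp1 : 1 ≤ p) (hp : p ≠ ⊤)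
    (hf : MemLp f p circleMeasure) :
    Filter.Tendsto (fun r => eLpNorm (dilate f r - f) p circleMeasure)
      (nhdsWithin (1 : ℝ) (Set.Iio 1)) (nhds 0) := by
  rw [ENNReal.tendsto_nhds_zero]
  intro ε hε
  rcases eq_or_ne ε ⊤ with rfl | hεt
  · exact Filter.Eventually.of_forall fun _ => le_top
  have hε3 : ε / 3 ≠ 0 := (ENNReal.div_pos hε.ne' (by simp)).ne'
  obtain ⟨g, hg, hgp⟩ := hf.exists_boundedContinuous_eLpNorm_sub_le hp hε3
  have hfi := hf.integrable hp1
  have hgi := hgp.integrable hp1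
  have hpos : 0 < (ε / 3).toReal := ENNReal.toReal_pos hε3
    (ENNReal.div_lt_top hεt (by simp)).ne
  filter_upwards [eventually_norm_dilate_sub_le g.continuous hpos, self_mem_nhdsWithin,
    nhdsWithin_le_nhds (lt_mem_nhds (zero_lt_one (α := ℝ)))] with r hr hr1 hr0
  have h0 : 0 ≤ r := le_of_lt hr0
  have h1 : r < 1 := hr1
  have e : dilate f r - f = (dilate (f - ⇑g) r + (dilate g r - ⇑g)) + (⇑g - f) := by
    rw [dilate_sub hfi hgi h0 h1]; abel
  have m1 : AEStronglyMeasurable (dilate (f - ⇑g) r) circleMeasure :=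
    aestronglyMeasurable_dilate (hfi.sub hgi) h0 h1
  have m2 : AEStronglyMeasurable (dilate g r - ⇑g) circleMeasure :=
    (aestronglyMeasurable_dilate hgi h0 h1).sub hgi.1
  have b1 : eLpNorm (dilate (f - ⇑g) r) p circleMeasure ≤ ε / 3 :=
    (eLpNorm_dilate_le (hf.1.sub hgp.1) hp1 hp h0 h1).trans hg
  have b2 : eLpNorm (dilate g r - ⇑g) p circleMeasure ≤ ε / 3 := by
    have := eLpNorm_le_of_ae_bound (p := p) (μ := circleMeasure) (f := dilate g r - ⇑g)
      (Filter.Eventually.of_forall hr)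
    rwa [measure_univ, ENNReal.one_rpow, one_mul, ENNReal.ofReal_toReal
      (ENNReal.div_lt_top hεt (by simp)).ne] at this
  have b3 : eLpNorm (⇑g - f) p circleMeasure ≤ ε / 3 := by rwa [eLpNorm_sub_comm]
  rw [e]
  calc _ ≤ eLpNorm (dilate (f - ⇑g) r + (dilate g r - ⇑g)) p circleMeasure
        + eLpNorm (⇑g - f) p circleMeasure := eLpNorm_add_le (m1.add m2) (hgi.1.sub hfi.1) hp1
    _ ≤ (ε / 3 + ε / 3) + ε / 3 :=
        add_le_add ((eLpNorm_add_le m1 m2 hp1).trans (add_le_add b1 b2)) b3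
    _ = ε := ENNReal.add_thirds ε

/-- The dilate of `F` is a power series in `s` converging uniformly on the circle, so
`poissonExt_pow_mul` applies term by term. -/
lemma poissonExt_mul_dilate {f F : UnitCircle → ℂ} (hf : Integrable f circleMeasure)
    (hF : Integrable F circleMeasure) (hmf : MomentsVanish f) (hmF : MomentsVanish F)
    {t : ℂ} (ht : t ∈ unitDisk) {r : ℝ} (h0 : 0 ≤ r) (h1 : r < 1) :
    poissonExt (fun s => dilate F r s * f s) t = poissonExt F (r * t) * poissonExt f t := by
  have hrt : (r : ℂ) * t ∈ unitDisk := by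
    have : ‖t‖ < 1 := by simpa using ht
    simp only [unitDisk, mem_ball_zero_iff, norm_mul, Complex.norm_real, Real.norm_of_nonneg h0]
    nlinarith [norm_nonneg t]
  set a : ℕ → ℂ := fun k => ∫ s : UnitCircle, (starRingEnd ℂ) (s : ℂ) ^ k * F s ∂circleMeasure
    with ha
  have hak : ∀ k, ‖a k‖ ≤ ∫ s, ‖F s‖ ∂circleMeasure := fun k => norm_moment_le k
  have hfk : ∀ k : ℕ, Integrable (fun s : UnitCircle => (s : ℂ) ^ k * f s) circleMeasure :=
    fun k => Integrable.continuous_mul hf (by fun_prop)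
  have hint : ∀ k : ℕ, Integrable (fun s : UnitCircle => ((r : ℂ) ^ k * a k) *
      (poissonKernel 0 t (s : ℂ) • ((s : ℂ) ^ k * f s))) circleMeasure := fun k =>
    (Integrable.poissonKernel_smul (hfk k) ht).const_mul _
  have hP : Integrable (fun s : UnitCircle => poissonKernel 0 t (s : ℂ) • f s) circleMeasure :=
    Integrable.poissonKernel_smul hf ht
  have hsum := hasSum_integral_of_summable_integral_norm hint (by
    refine Summable.of_nonneg_of_le (fun k => integral_nonneg fun s => norm_nonneg _) (fun k => ?_)
      (((summable_geometric_of_lt_one h0 h1).mul_right (∫ s, ‖F s‖ ∂circleMeasure)).mul_right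
        (∫ s : UnitCircle, ‖poissonKernel 0 t (s : ℂ) • f s‖ ∂circleMeasure))
    refine (integral_mono (hint k).norm (hP.norm.const_mul (r ^ k * ∫ s, ‖F s‖ ∂circleMeasure))
      fun s => ?_).trans_eq (integral_const_mul _ _)
    simp only [norm_mul, norm_smul, norm_pow, norm_coe_unitCircle, one_pow, one_mul,
      Complex.norm_real, Real.norm_of_nonneg h0]
    gcongr
    exact hak k)
  have hterm : ∀ k : ℕ, ∫ s : UnitCircle, ((r : ℂ) ^ k * a k) *
      (poissonKernel 0 t (s : ℂ) • ((s : ℂ) ^ k * f s)) ∂circleMeasure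
      = ((r * t) ^ k * a k) * poissonExt f t := fun k => by
    rw [integral_const_mul]
    have := hmf.poissonExt_pow_mul hf ht k
    rw [poissonExt] at this
    rw [this, mul_pow]
    ring
  simp only [hterm] at hsum
  have h2 := (hmF.hasSum_poissonExt hF hrt).mul_right (poissonExt f t)
  rw [h2.unique hsum, poissonExt]
  congr 1; ext s
  have h3 := (hmF.hasSum_poissonExt hF (mul_coe_mem_unitDisk h0 h1 s)).mul_right
    (poissonKernel 0 t (s : ℂ) • f s)
  rw [dilate, ← smul_mul_assoc, smul_mul_assoc, ← mul_smul_comm, ← h3.tsum_eq]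
  congr 1; ext k
  simp only [Complex.real_smul, mul_pow, ha]
  ring

/-- The Poisson extension is multiplicative on boundary functions of Hardy functions with
conjugate exponents. -/
lemma poissonExt_mul {f F : UnitCircle → ℂ} {p q : ENNReal} [hpq : p.HolderConjugate q]
    (hp : p ≠ ⊤) (hF : MemLp F p circleMeasure) (hf : MemLp f q circleMeasure)
    (hmF : MomentsVanish F) (hmf : MomentsVanish f) {t : ℂ} (ht : t ∈ unitDisk) :
    poissonExt (fun s => F s * f s) t = poissonExt F t * poissonExt f t := by
  have hp1 : 1 ≤ p := ENNReal.HolderConjugate.one_le p q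
  have hq1 : 1 ≤ q := ENNReal.HolderConjugate.one_le q p
  have hFi := hF.integrable hp1
  have hfi := hf.integrable hq1
  have hg : MemLp (fun s : UnitCircle => poissonKernel 0 t (s : ℂ) • f s) q circleMeasure :=
    MemLp.of_le_mul (c := (1 + ‖t‖) / (1 - ‖t‖)) hf (Integrable.poissonKernel_smul hfi ht).1
      (Filter.Eventually.of_forall fun s => by
        rw [norm_smul]
        gcongr
        exact norm_poissonKernel_le ht s)
  set g := fun s : UnitCircle => poissonKernel 0 t (s : ℂ) • f s with hgdef
  have hev : ∀ᶠ r in nhdsWithin (1 : ℝ) (Set.Iio 1), (0 : ℝ) ≤ r ∧ r < 1 := by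
    filter_upwards [self_mem_nhdsWithin,
      nhdsWithin_le_nhds (lt_mem_nhds (zero_lt_one (α := ℝ)))] with r hr1 hr0
    exact ⟨le_of_lt hr0, hr1⟩
  have hdm : ∀ r : ℝ, 0 ≤ r → r < 1 → MemLp (dilate F r) p circleMeasure := fun r h0 h1 =>
    ⟨aestronglyMeasurable_dilate hFi h0 h1,
      (eLpNorm_dilate_le hF.1 hp1 hp h0 h1).trans_lt hF.2⟩
  -- Only `F` is dilated. Hölder's inequality pairs its `L^p` convergence with the fixed `g ∈ L^q`,
  -- so the exponent `q` is allowed to be infinite.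
  have hlim : Filter.Tendsto (fun r : ℝ => ∫ s, (dilate F r * g) s ∂circleMeasure)
      (nhdsWithin (1 : ℝ) (Set.Iio 1)) (nhds (∫ s, (F * g) s ∂circleMeasure)) := by
    refine tendsto_integral_of_L1' _ (hF.integrable_mul hg).1 ?_ ?_
    · filter_upwards [hev] with r hr
      exact (hdm r hr.1 hr.2).integrable_mul hg
    · have hz : Filter.Tendsto (fun r => eLpNorm (dilate F r - F) p circleMeasure *
          eLpNorm g q circleMeasure) (nhdsWithin (1 : ℝ) (Set.Iio 1)) (nhds 0) := by
        have := ENNReal.Tendsto.mul_const (b := eLpNorm g q circleMeasure)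
          (tendsto_eLpNorm_dilate_sub hp1 hp hF) (Or.inr hg.2.ne)
        simpa using this
      refine tendsto_of_tendsto_of_tendsto_of_le_of_le' tendsto_const_nhds hz
        (Filter.Eventually.of_forall fun _ => zero_le) ?_
      filter_upwards [hev] with r hr
      rw [← sub_mul]
      have h5 := eLpNorm_smul_le_mul_eLpNorm (p := p) (q := q) (r := 1) (f := g)
        (φ := dilate F r - F) hg.1 ((hdm r hr.1 hr.2).1.sub hF.1)
      refine le_trans (le_of_eq (eLpNorm_congr_norm_ae (Filter.Eventually.of_forall fun s => ?_))) h5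
      rfl
  have hlim2 : Filter.Tendsto (fun r : ℝ => poissonExt F (r * t) * poissonExt f t)
      (nhdsWithin (1 : ℝ) (Set.Iio 1)) (nhds (poissonExt F t * poissonExt f t)) := by
    refine Filter.Tendsto.mul_const _ (Filter.Tendsto.mono_left ?_ nhdsWithin_le_nhds)
    have hc : ContinuousAt (poissonExt F) (((1 : ℝ) : ℂ) * t) := by
      rw [Complex.ofReal_one, one_mul]
      exact ((hmF.differentiableOn hFi).differentiableAt
        (Metric.isOpen_ball.mem_nhds ht)).continuousAt
    have h3 : ContinuousAt (fun r : ℝ => poissonExt F (r * t)) 1 :=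
      ContinuousAt.comp (f := fun r : ℝ => (r : ℂ) * t) hc (by fun_prop)
    have h4 := h3.tendsto
    simpa using h4
  have heq : ∀ᶠ r in nhdsWithin (1 : ℝ) (Set.Iio 1), ∫ s, (dilate F r * g) s ∂circleMeasure
      = poissonExt F (r * t) * poissonExt f t := by
    filter_upwards [hev] with r hr
    rw [← poissonExt_mul_dilate hfi hFi hmf hmF ht hr.1 hr.2, poissonExt]
    congr 1; ext s
    simp only [Pi.mul_apply, hgdef, mul_smul_comm]
  have := tendsto_nhds_unique hlim (hlim2.congr' (heq.mono fun _ h => h.symm))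
  rw [← this, poissonExt]
  congr 1; ext s
  simp only [Pi.mul_apply, hgdef, mul_smul_comm]

/-! ### Vector-valued Hardy functions and order properties of the Poisson integral. -/

lemma memLp_apply {n : ℕ} {p : ENNReal} {f : UnitCircle → Cn n} (hf : MemLp f p circleMeasure)
    (j : Fin n) : MemLp (fun s => f s j) p circleMeasure :=
  (EuclideanSpace.proj j : Cn n →L[ℂ] ℂ).comp_memLp' hf

lemma poissonExt_apply {n : ℕ} {f : UnitCircle → Cn n} (hf : Integrable f circleMeasure)
    {t : ℂ} (ht : t ∈ unitDisk) (j : Fin n) :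
    poissonExt f t j = poissonExt (fun s => f s j) t := by
  have h := (EuclideanSpace.proj j : Cn n →L[ℂ] ℂ).integral_comp_comm
    (Integrable.poissonKernel_smul hf ht)
  exact h.symm

lemma poissonExt_congr_ae {E : Type*} [NormedAddCommGroup E] [NormedSpace ℝ E]
    {f g : UnitCircle → E} (h : f =ᵐ[circleMeasure] g) (t : ℂ) :
    poissonExt f t = poissonExt g t := by
  refine integral_congr_ae ?_
  filter_upwards [h] with s hs
  rw [hs]

lemma IsHardy.integrable {n : ℕ} {r : ℝ} (hr : 1 ≤ r) {F : ℂ → Cn n} {f : UnitCircle → Cn n}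
    (h : IsHardy r F f) : Integrable f circleMeasure :=
  h.memLp.integrable (by simpa using hr)

lemma IsHardy.apply_eq {n : ℕ} {r : ℝ} (hr : 1 ≤ r) {F : ℂ → Cn n} {f : UnitCircle → Cn n}
    (h : IsHardy r F f) {t : ℂ} (ht : t ∈ unitDisk) (j : Fin n) :
    F t j = poissonExt (fun s => f s j) t := by
  rw [h.eq_poissonExt t ht, poissonExt_apply (h.integrable hr) ht]

lemma IsHardy.momentsVanish {n : ℕ} {r : ℝ} (hr : 1 ≤ r) {F : ℂ → Cn n} {f : UnitCircle → Cn n}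
    (h : IsHardy r F f) (j : Fin n) : MomentsVanish (fun s => f s j) := by
  have hi := h.integrable hr
  refine momentsVanish_of_differentiableOn ((EuclideanSpace.proj j : Cn n →L[ℂ] ℂ).integrable_comp hi) ?_
  have hd : DifferentiableOn ℂ (fun t => F t j) unitDisk :=
    (EuclideanSpace.proj j : Cn n →L[ℂ] ℂ).differentiable.comp_differentiableOn
      h.holomorphic
  exact hd.congr fun t ht => (h.apply_eq hr ht j).symm

lemma isHardy_of_momentsVanish {n : ℕ} {r : ℝ} (hr : 1 ≤ r) {F : ℂ → Cn n}
    {f : UnitCircle → Cn n} (hf : MemLp f (ENNReal.ofReal r) circleMeasure)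
    (hm : ∀ j, MomentsVanish (fun s => f s j)) (hF : ∀ t ∈ unitDisk, F t = poissonExt f t) :
    IsHardy r F f := by
  have hi : Integrable f circleMeasure := hf.integrable (by simpa using hr)
  refine ⟨hf, ?_, hF⟩
  rw [differentiableOn_euclidean]
  intro j
  refine ((hm j).differentiableOn ((EuclideanSpace.proj j : Cn n →L[ℂ] ℂ).integrable_comp hi)).congr
    fun t ht => ?_
  rw [hF t ht, poissonExt_apply hi ht]
  rfl

lemma momentsVanish_polynomial (P : Polynomial ℂ) (c : ℂ) :
    MomentsVanish (fun s => P.eval (s : ℂ) * c) := fun k => by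
  have h := poissonExt_of_diffContOnCl (u := fun z : ℂ => z ^ (k + 1) * (P.eval z * c)) (t := 0)
    (Differentiable.diffContOnCl (by fun_prop)) (by simp)
  simpa [poissonExt, poissonKernel_coe] using h

lemma isHardy_polynomial {n : ℕ} {r : ℝ} (hr : 1 ≤ r) (P : Polynomial ℂ) (x : Cn n) :
    IsHardy r (fun t => P.eval t • x) (fun s => P.eval (s : ℂ) • x) := by
  have hc : Continuous (fun s : UnitCircle => P.eval (s : ℂ) • x) := by fun_prop
  refine isHardy_of_momentsVanish hr ?_ (fun j => ?_) fun t ht => ?_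
  · obtain ⟨C, hC⟩ := (isCompact_range hc).isBounded.exists_norm_le
    exact MemLp.of_bound hc.aestronglyMeasurable C
      (Filter.Eventually.of_forall fun s => hC _ ⟨s, rfl⟩)
  · simpa using momentsVanish_polynomial P (x j)
  · exact (poissonExt_of_diffContOnCl (u := fun z : ℂ => P.eval z • x)
      (Differentiable.diffContOnCl (by fun_prop)) ht).symm

lemma IsHardy.linComb {n : ℕ} {r : ℝ} (hr : 1 ≤ r) {F G : ℂ → Cn n} {f g : UnitCircle → Cn n}
    (hF : IsHardy r F f) (hG : IsHardy r G g) (a b : ℝ) :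
    IsHardy r (fun t => a • F t + b • G t) (fun s => a • f s + b • g s) := by
  refine ⟨(hF.memLp.const_smul a).add (hG.memLp.const_smul b),
    (hF.holomorphic.const_smul a).add (hG.holomorphic.const_smul b), fun t ht => ?_⟩
  rw [hF.eq_poissonExt t ht, hG.eq_poissonExt t ht]
  simp only [poissonExt, smul_add, smul_comm _ a, smul_comm _ b]
  rw [← integral_smul, ← integral_smul]
  exact (integral_add ((Integrable.poissonKernel_smul (hF.integrable hr) ht).smul a)
    ((Integrable.poissonKernel_smul (hG.integrable hr) ht).smul b)).symm

lemma IsHardy.add {n : ℕ} {r : ℝ} (hr : 1 ≤ r) {F G : ℂ → Cn n} {f g : UnitCircle → Cn n}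
    (hF : IsHardy r F f) (hG : IsHardy r G g) :
    IsHardy r (fun t => F t + G t) (fun s => f s + g s) := by
  simpa using hF.linComb hr hG 1 1

lemma integrable_complex_re {h : UnitCircle → ℂ} (hh : Integrable h circleMeasure) :
    Integrable (fun s => (h s).re) circleMeasure := hh.re

lemma poissonExt_re {h : UnitCircle → ℂ} (hh : Integrable h circleMeasure) {t : ℂ}
    (ht : t ∈ unitDisk) : poissonExt (fun s => (h s).re) t = (poissonExt h t).re := by
  have := integral_re (Integrable.poissonKernel_smul hh ht)
  rw [poissonExt, poissonExt, ← RCLike.re_eq_complex_re, ← this]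
  simp

lemma poissonExt_mono {f g : UnitCircle → ℝ} (hf : Integrable f circleMeasure)
    (hg : Integrable g circleMeasure) (h : f ≤ᵐ[circleMeasure] g) {t : ℂ} (ht : t ∈ unitDisk) :
    poissonExt f t ≤ poissonExt g t := by
  refine integral_mono_ae (Integrable.poissonKernel_smul hf ht)
    (Integrable.poissonKernel_smul hg ht) ?_
  filter_upwards [h] with s hs
  exact mul_le_mul_of_nonneg_left hs (poissonKernel_pos ht s).le

lemma poissonExt_add {f g : UnitCircle → ℝ} (hf : Integrable f circleMeasure)
    (hg : Integrable g circleMeasure) {t : ℂ} (ht : t ∈ unitDisk) :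
    poissonExt (fun s => f s + g s) t = poissonExt f t + poissonExt g t := by
  simp only [poissonExt, smul_add]
  exact integral_add (Integrable.poissonKernel_smul hf ht) (Integrable.poissonKernel_smul hg ht)

lemma poissonExt_sub {f g : UnitCircle → ℝ} (hf : Integrable f circleMeasure)
    (hg : Integrable g circleMeasure) {t : ℂ} (ht : t ∈ unitDisk) :
    poissonExt (fun s => f s - g s) t = poissonExt f t - poissonExt g t := by
  simp only [poissonExt, smul_sub]
  exact integral_sub (Integrable.poissonKernel_smul hf ht) (Integrable.poissonKernel_smul hg ht)

lemma dotC_comm {n : ℕ} (z w : Cn n) : dotC z w = dotC w z := by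
  simp [dotC, mul_comm]

/-! ### Duality for the interpolant. -/

section Hoelder

variable {n : ℕ} {p q : ℝ}

lemma integrable_dotC (hpq : p.HolderConjugate q) {f g : UnitCircle → Cn n}
    (hf : MemLp f (ENNReal.ofReal p) circleMeasure)
    (hg : MemLp g (ENNReal.ofReal q) circleMeasure) :
    Integrable (fun s => dotC (f s) (g s)) circleMeasure := by
  have := hpq.ennrealOfReal
  exact integrable_finsetSum _ fun j _ => (memLp_apply hf j).integrable_mul (memLp_apply hg j)

lemma poissonExt_dotC (hpq : p.HolderConjugate q) {F G : ℂ → Cn n} {f g : UnitCircle → Cn n}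
    (hF : IsHardy p F f) (hG : IsHardy q G g) {t : ℂ} (ht : t ∈ unitDisk) :
    poissonExt (fun s => dotC (f s) (g s)) t = dotC (F t) (G t) := by
  have := hpq.ennrealOfReal
  have hint : ∀ j, Integrable (fun s => f s j * g s j) circleMeasure := fun j =>
    (memLp_apply hF.memLp j).integrable_mul (memLp_apply hG.memLp j)
  simp only [poissonExt, dotC, Finset.smul_sum]
  rw [integral_finsetSum _ fun j _ => Integrable.poissonKernel_smul (hint j) ht]
  refine Finset.sum_congr rfl fun j _ => ?_
  have h := poissonExt_mul (p := ENNReal.ofReal p) (q := ENNReal.ofReal q) ENNReal.ofReal_ne_top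
    (memLp_apply hF.memLp j) (memLp_apply hG.memLp j) (hF.momentsVanish hpq.lt.le j)
    (hG.momentsVanish hpq.symm.lt.le j) ht
  rw [hF.apply_eq hpq.lt.le ht, hG.apply_eq hpq.symm.lt.le ht, ← h]
  rfl

/-- The set whose supremum is the interpolant. -/
def interpolantSet (q : ℝ) (φ : UnitCircle → Cn n → ℝ) (t : ℂ) (w : Cn n) : Set ℝ :=
  {x : ℝ | ∃ (f₀ : UnitCircle → ℂ) (F : ℂ → Cn n) (f : UnitCircle → Cn n),
    MemLp f₀ 1 circleMeasure ∧ IsHardy q F f ∧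
    (∀ᵐ s ∂circleMeasure, legendre (φ s) (f s) ≤ (f₀ s).re) ∧
    x = (dotC (F t) w).re - poissonExt (fun s => (f₀ s).re) t}

lemma interpolant_eq_sSup (hpq : p.HolderConjugate q) (φ : UnitCircle → Cn n → ℝ) (t : ℂ)
    (w : Cn n) : interpolant p φ t w = sSup (interpolantSet q φ t w) := by
  rw [hpq.conjugate_eq]
  rfl

/-- Weak duality: every competitor in the interpolant is bounded by the Poisson integral of the
boundary data along a Hardy function. -/
lemma poissonExt_mem_upperBounds (hpq : p.HolderConjugate q) {φ : UnitCircle → Cn n → ℝ}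
    {F : ℂ → Cn n} {f : UnitCircle → Cn n} (hF : IsHardy p F f) {h : UnitCircle → ℝ}
    (hh : Integrable h circleMeasure)
    (hφ : ∀ s z, (dotC z (f s)).re ≤ legendre (φ s) z + h s) {t : ℂ} (ht : t ∈ unitDisk) :
    poissonExt h t ∈ upperBounds (interpolantSet q φ t (F t)) := by
  rintro x ⟨f₀, G, g, hf₀, hG, hle, rfl⟩
  have hf₀i : Integrable f₀ circleMeasure := memLp_one_iff_integrable.mp hf₀
  have hdot := integrable_dotC hpq.symm hG.memLp hF.memLp
  rw [sub_le_iff_le_add, ← poissonExt_dotC hpq.symm hG hF ht, ← poissonExt_re hdot ht,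
    ← poissonExt_add hh (integrable_complex_re hf₀i) ht]
  refine poissonExt_mono (integrable_complex_re hdot) (hh.add (integrable_complex_re hf₀i)) ?_ ht
  filter_upwards [hle] with s hs
  have := hφ s (g s)
  simp only [Pi.add_apply]
  linarith

lemma interpolant_le_poissonExt (hpq : p.HolderConjugate q) {φ : UnitCircle → Cn n → ℝ}
    {F : ℂ → Cn n} {f : UnitCircle → Cn n} (hF : IsHardy p F f) {h : UnitCircle → ℝ}
    (hh : Integrable h circleMeasure)
    (hφ : ∀ s z, (dotC z (f s)).re ≤ legendre (φ s) z + h s) {t : ℂ} (ht : t ∈ unitDisk)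
    (hne : (interpolantSet q φ t (F t)).Nonempty) :
    interpolant p φ t (F t) ≤ poissonExt h t := by
  rw [interpolant_eq_sSup hpq]
  exact csSup_le hne (poissonExt_mem_upperBounds hpq hF hh hφ ht)

/-- Strong duality for a pair of Hardy functions that are conjugate almost everywhere on the
boundary. -/
lemma interpolant_eq_poissonExt (hpq : p.HolderConjugate q) {φ : UnitCircle → Cn n → ℝ}
    {F G : ℂ → Cn n} {f g : UnitCircle → Cn n} (hF : IsHardy p F f) (hG : IsHardy q G g)
    {h : UnitCircle → ℝ} (hh : Integrable h circleMeasure)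
    (hφ : ∀ s z, (dotC z (f s)).re ≤ legendre (φ s) z + h s)
    (hconj : ∀ s, legendre (φ s) (g s) ≤ (dotC (g s) (f s)).re - h s)
    {t : ℂ} (ht : t ∈ unitDisk) :
    interpolant p φ t (F t) = poissonExt h t := by
  have hdot := integrable_dotC hpq.symm hG.memLp hF.memLp
  have hmem : poissonExt h t ∈ interpolantSet q φ t (F t) := by
    -- This `f₀` is the largest value the Fenchel bound permits, so the Poisson integral of `Re (g ·
    -- f)` cancels `Re (G · F)` and leaves that of `h`.
    refine ⟨fun s => (((dotC (g s) (f s)).re - h s : ℝ) : ℂ), G, g, ?_, hG, ?_, ?_⟩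
    · rw [memLp_one_iff_integrable]
      exact ((integrable_complex_re hdot).sub hh).ofReal
    · exact Filter.Eventually.of_forall fun s => by simpa using hconj s
    · simp only [Complex.ofReal_re]
      rw [← poissonExt_dotC hpq.symm hG hF ht, ← poissonExt_re hdot ht,
        poissonExt_sub (integrable_complex_re hdot) hh ht]
      simp
  refine le_antisymm (interpolant_le_poissonExt hpq hF hh hφ ht ⟨_, hmem⟩) ?_
  rw [interpolant_eq_sSup hpq]
  exact le_csSup ⟨_, poissonExt_mem_upperBounds hpq hF hh hφ ht⟩ hmem

end Hoelder

/-! ### Convex analysis on `ℂⁿ`: gradients, Legendre transform, growth. -/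

section Pointwise

variable {n : ℕ}

/-- The real bilinear form `(z, w) ↦ Re (z · w)`. -/
noncomputable def reDot (n : ℕ) : Cn n →L[ℝ] Cn n →L[ℝ] ℝ :=
  LinearMap.toContinuousLinearMap
    ((LinearMap.toContinuousLinearMap : (Cn n →ₗ[ℝ] ℝ) ≃ₗ[ℝ] (Cn n →L[ℝ] ℝ)).toLinearMap ∘ₗ
      LinearMap.mk₂ ℝ (fun z w : Cn n => (dotC z w).re)
        (fun a b c => by simp [dotC, add_mul, Finset.sum_add_distrib])
        (fun r a b => by simp [dotC, Finset.mul_sum, mul_assoc, mul_sub])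
        (fun a b c => by simp [dotC, mul_add, Finset.sum_add_distrib])
        (fun r a b => by simp [dotC, Finset.mul_sum, mul_left_comm, mul_sub]))

@[simp] lemma reDot_apply (z w : Cn n) : reDot n z w = (dotC z w).re := rfl

lemma dotC_smul_left (a : ℂ) (z w : Cn n) : dotC (a • z) w = a * dotC z w := by
  simp [dotC, Finset.mul_sum, mul_assoc]

lemma dotC_smul_right (a : ℂ) (z w : Cn n) : dotC z (a • w) = a * dotC z w := by
  simp [dotC, Finset.mul_sum, mul_left_comm]

lemma dotC_single_right (z : Cn n) (j : Fin n) (a : ℂ) :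
    dotC z (EuclideanSpace.single j a) = z j * a := by
  simp [dotC]

lemma eq_of_forall_re_dotC_eq {z z' : Cn n} (h : ∀ v, (dotC z v).re = (dotC z' v).re) :
    z = z' := by
  ext j
  have h1 := h (EuclideanSpace.single j 1)
  have h2 := h (EuclideanSpace.single j Complex.I)
  rw [dotC_single_right, dotC_single_right] at h1 h2
  apply Complex.ext
  · simpa using h1
  · simpa using h2

lemma sum_single_eq (v : Cn n) : ∑ j, EuclideanSpace.single j (v j) = v := by
  ext i
  simp

lemma fderiv_eq_reDot (ψ : Cn n → ℝ) (w : Cn n) :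
    fderiv ℝ ψ w = reDot n (complexGradient ψ w) := by
  ext v
  have hv : ∀ (j : Fin n) (a : ℂ), (EuclideanSpace.single j a : Cn n) =
      a.re • EuclideanSpace.single j (1 : ℂ) + a.im • EuclideanSpace.single j Complex.I := by
    intro j a
    ext i
    by_cases h : i = j
    · subst h
      simpa [mul_comm] using (Complex.re_add_im a).symm
    · simp [h]
  conv_lhs => rw [← sum_single_eq v, map_sum]
  rw [reDot_apply, dotC, Complex.re_sum]
  refine Finset.sum_congr rfl fun j _ => ?_
  rw [hv j (v j), map_add, map_smul, map_smul]
  simp [complexGradient]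
  ring

lemma norm_complexGradient_le {ψ : Cn n → ℝ} {w : Cn n} {D : ℝ}
    (h : ∀ v, ‖v‖ ≤ 1 → |fderiv ℝ ψ w v| ≤ D) : ‖complexGradient ψ w‖ ≤ n * (2 * D) := by
  rw [← sum_single_eq (complexGradient ψ w)]
  refine (norm_sum_le _ _).trans ?_
  have : ∀ j ∈ Finset.univ, ‖(EuclideanSpace.single j (complexGradient ψ w j) : Cn n)‖ ≤ 2 * D := by
    intro j _
    rw [PiLp.norm_single]
    simp only [complexGradient]
    refine (norm_sub_le _ _).trans ?_
    rw [norm_mul, Complex.norm_I, one_mul, Complex.norm_real, Complex.norm_real, two_mul]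
    exact add_le_add (h _ (by simp)) (h _ (by simp))
  refine (Finset.sum_le_sum this).trans_eq ?_
  simp

/-- The tangent plane of a convex function lies below its graph. -/
lemma add_fderiv_le_of_convexOn {E : Type*} [NormedAddCommGroup E] [NormedSpace ℝ E]
    {ψ : E → ℝ} (hc : ConvexOn ℝ Set.univ ψ) {w : E} (hd : DifferentiableAt ℝ ψ w) (v : E) :
    ψ w + fderiv ℝ ψ w v ≤ ψ (w + v) := by
  have hline : ConvexOn ℝ Set.univ (fun τ : ℝ => ψ (w + τ • v)) := by
    have := hc.comp_affineMap (AffineMap.lineMap w (w + v))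
    simpa [Function.comp_def, AffineMap.lineMap_apply, add_comm] using this
  have hder : HasDerivAt (fun τ : ℝ => ψ (w + τ • v)) (fderiv ℝ ψ w v) 0 := by
    have h1 : HasDerivAt (fun τ : ℝ => w + τ • v) v 0 := by
      simpa using ((hasDerivAt_id (0 : ℝ)).smul_const v).const_add w
    have h2 : HasFDerivAt ψ (fderiv ℝ ψ w) (w + (0 : ℝ) • v) := by simpa using hd.hasFDerivAt
    exact h2.comp_hasDerivAt 0 h1
  have := hline.le_slope_of_hasDerivAt (Set.mem_univ _) (Set.mem_univ 1) zero_lt_one hder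
  simp [slope_def_field] at this
  linarith

lemma re_dotC_complexGradient_sub_le {ψ : Cn n → ℝ} (hc : ConvexOn ℝ Set.univ ψ)
    {w : Cn n} (hd : DifferentiableAt ℝ ψ w) (v : Cn n) :
    (dotC (complexGradient ψ w) v).re - ψ v ≤ (dotC (complexGradient ψ w) w).re - ψ w := by
  have h := add_fderiv_le_of_convexOn hc hd (v - w)
  rw [fderiv_eq_reDot, map_sub, reDot_apply, reDot_apply] at h
  simp only [add_sub_cancel] at h
  linarith

/-- Equality in the Fenchel-Young inequality at the gradient. -/
lemma legendre_complexGradient {ψ : Cn n → ℝ} (hc : ConvexOn ℝ Set.univ ψ)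
    {w : Cn n} (hd : DifferentiableAt ℝ ψ w) :
    legendre ψ (complexGradient ψ w) = (dotC (complexGradient ψ w) w).re - ψ w := by
  refine le_antisymm (ciSup_le (re_dotC_complexGradient_sub_le hc hd)) ?_
  refine le_ciSup (f := fun v => (dotC (complexGradient ψ w) v).re - ψ v)
    ⟨(dotC (complexGradient ψ w) w).re - ψ w, ?_⟩ w
  rintro _ ⟨v, rfl⟩
  exact re_dotC_complexGradient_sub_le hc hd v

lemma bddAbove_legendre {ψ : Cn n → ℝ} {p c A : ℝ} (hp : 1 < p) (hc : 0 < c)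
    (hlo : ∀ w, c * ‖w‖ ^ p - A ≤ ψ w) (z : Cn n) :
    BddAbove (Set.range fun w : Cn n => (dotC z w).re - ψ w) := by
  set K := ‖reDot n z‖ with hK
  -- The radius at which `K‖w‖ = c‖w‖^p`; beyond it the growth of `ψ` beats the linear term.
  set x₀ := (K / c) ^ (p - 1)⁻¹ with hx₀
  have hK0 : 0 ≤ K := norm_nonneg _
  have hx00 : 0 ≤ x₀ := by positivity
  have hp1 : 0 < p - 1 := by linarith
  refine ⟨K * x₀ + A, ?_⟩
  rintro _ ⟨w, rfl⟩
  have h1 : (dotC z w).re ≤ K * ‖w‖ := by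
    rw [← reDot_apply]
    exact (le_abs_self _).trans ((reDot n z).le_opNorm w)
  have h2 : K * ‖w‖ - c * ‖w‖ ^ p ≤ K * x₀ := by
    rcases le_total ‖w‖ x₀ with h | h
    · have : 0 ≤ c * ‖w‖ ^ p := by positivity
      have := mul_le_mul_of_nonneg_left h hK0
      linarith
    · have h3 : K / c ≤ ‖w‖ ^ (p - 1) := by
        calc K / c = x₀ ^ (p - 1) := by
              rw [hx₀, ← Real.rpow_mul (by positivity), inv_mul_cancel₀ hp1.ne', Real.rpow_one]
          _ ≤ _ := by gcongr
      have h4 : ‖w‖ ^ p = ‖w‖ ^ (p - 1) * ‖w‖ := by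
        rcases (norm_nonneg w).eq_or_lt with h0 | h0
        · rw [← h0, Real.zero_rpow (by linarith), mul_zero]
        · rw [← Real.rpow_add_one h0.ne']; simp
      have h5 : K * ‖w‖ ≤ c * ‖w‖ ^ p := by
        rw [h4, ← mul_assoc]
        gcongr
        rwa [div_le_iff₀' hc] at h3
      have : 0 ≤ K * x₀ := by positivity
      linarith
  have := hlo w
  simp only
  linarith

lemma re_dotC_le_legendre_add {ψ : Cn n → ℝ} {z : Cn n}
    (h : BddAbove (Set.range fun w : Cn n => (dotC z w).re - ψ w)) (w : Cn n) :
    (dotC z w).re ≤ legendre ψ z + ψ w := by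
  have := le_ciSup h w
  rw [← sub_le_iff_le_add]
  exact this

/-- The easy half of the Fenchel-Moreau theorem. -/
lemma legendre_legendre_le {ψ : Cn n → ℝ}
    (h : ∀ z, BddAbove (Set.range fun w : Cn n => (dotC z w).re - ψ w)) (w : Cn n) :
    legendre (legendre ψ) w ≤ ψ w := by
  refine ciSup_le fun z => ?_
  have := re_dotC_le_legendre_add (h z) w
  rw [dotC_comm w z]
  linarith

/-- Young's inequality already bounds the range by `ψ w`, so no growth estimate for the conjugate is
needed. -/
lemma bddAbove_legendre_legendre {ψ : Cn n → ℝ}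
    (h : ∀ z, BddAbove (Set.range fun w : Cn n => (dotC z w).re - ψ w)) (w : Cn n) :
    BddAbove (Set.range fun z : Cn n => (dotC w z).re - legendre ψ z) := by
  refine ⟨ψ w, ?_⟩
  rintro _ ⟨z, rfl⟩
  have := re_dotC_le_legendre_add (h z) w
  simp only
  rw [dotC_comm w z]
  linarith

/-- The gradient of a convex function of `p`-growth has `(p - 1)`-growth. -/
lemma norm_complexGradient_le_of_growth {ψ : Cn n → ℝ} {p c C A : ℝ} (hp : 1 < p) (hc : 0 < c)
    (hC : 0 < C) (hA : 0 < A) (hlo : ∀ w, c * ‖w‖ ^ p - A ≤ ψ w)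
    (hhi : ∀ w, ψ w ≤ C * ‖w‖ ^ p + A) (hconv : ConvexOn ℝ Set.univ ψ)
    (hd : Differentiable ℝ ψ) (w : Cn n) :
    ‖complexGradient ψ w‖ ≤ n * (2 * (C * 2 ^ p + 2 * A)) * (‖w‖ + 1) ^ (p - 1) := by
  set τ := ‖w‖ + 1 with hτ
  have hw := norm_nonneg w
  have hτ1 : 1 ≤ τ := by linarith
  have hτ0 : 0 < τ := by linarith
  have hpow : τ ^ p = τ ^ (p - 1) * τ := by rw [← Real.rpow_add_one hτ0.ne']; simp
  have hone : ∀ v, ‖v‖ ≤ 1 → fderiv ℝ ψ w v ≤ (C * 2 ^ p + 2 * A) * τ ^ (p - 1) := fun v hv => by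
    -- A step of length comparable to `‖w‖ + 1` keeps `ψ` of size `τ^p`; dividing by `τ` yields the
    -- exponent `p - 1`.
    have h1 := add_fderiv_le_of_convexOn hconv (hd w) (τ • v)
    rw [map_smul, smul_eq_mul] at h1
    have h2 : ‖w + τ • v‖ ≤ 2 * τ := by
      refine (norm_add_le _ _).trans ?_
      rw [norm_smul, Real.norm_of_nonneg hτ0.le]
      nlinarith
    have h3 : ‖w + τ • v‖ ^ p ≤ 2 ^ p * τ ^ p := by
      rw [← Real.mul_rpow (by norm_num) hτ0.le]
      gcongr
    have h4 := hhi (w + τ • v)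
    have h5 := hlo w
    have h6 : 0 ≤ c * ‖w‖ ^ p := by positivity
    have h7 : C * ‖w + τ • v‖ ^ p ≤ C * (2 ^ p * τ ^ p) := by gcongr
    have h8 : 1 ≤ τ ^ p := Real.one_le_rpow hτ1 (by linarith)
    have h9 : 2 * A ≤ 2 * A * τ ^ p := by nlinarith
    have h10 : τ * fderiv ℝ ψ w v ≤ (C * 2 ^ p + 2 * A) * τ ^ p := by nlinarith
    rw [hpow, ← mul_assoc, mul_comm τ] at h10
    exact le_of_mul_le_mul_right h10 hτ0
  have h := norm_complexGradient_le (ψ := ψ) (w := w) (D := (C * 2 ^ p + 2 * A) * τ ^ (p - 1))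
    fun v hv => abs_le'.mpr ⟨hone v hv, by
      have := hone (-v) (by simpa using hv)
      simpa using this⟩
  linarith

/-- A convex function that is touched from above by a differentiable function is differentiable. -/
lemma hasFDerivAt_of_convexOn_of_le {E : Type*} [NormedAddCommGroup E] [NormedSpace ℝ E]
    {N K : E → ℝ} {K' : E →L[ℝ] ℝ} (hN : ConvexOn ℝ Set.univ N) {w : E}
    (hK : HasFDerivAt (fun x => K x) K' 0) (hle : ∀ x, N (w + x) ≤ K x) (heq : N w = K 0) :
    HasFDerivAt N K' w := by
  rw [hasFDerivAt_iff_isLittleO_nhds_zero] at hK ⊢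
  simp only [zero_add] at hK
  have hK2 : (fun h : E => K (-h) - K 0 - K' (-h)) =o[nhds 0] fun h : E => h := by
    have hneg : Filter.Tendsto (fun h : E => -h) (nhds 0) (nhds 0) := by
      simpa using (continuous_neg (G := E)).tendsto 0
    have := (hK.comp_tendsto hneg).neg_right
    simpa [Function.comp_def] using this
  refine Asymptotics.IsLittleO.of_bound fun ε hε => ?_
  filter_upwards [hK.bound hε, hK2.bound hε] with h h1 h2
  have h3 := hle h
  have h4 := hle (-h)
  -- Midpoint convexity turns the upper bound at `w - h` into the missing lower bound at `w + h`.
  have h5 : 2 * N w ≤ N (w + h) + N (w + -h) := by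
    have := hN.2 (Set.mem_univ (w + h)) (Set.mem_univ (w + -h)) 
      (by norm_num : (0 : ℝ) ≤ 1 / 2) (by norm_num : (0 : ℝ) ≤ 1 / 2) (by norm_num)
    have e : (1 / 2 : ℝ) • (w + h) + (1 / 2 : ℝ) • (w + -h) = w := by
      rw [← smul_add, add_add_add_comm, add_neg_cancel, add_zero, ← two_smul ℝ w, smul_smul]
      norm_num
    rw [e] at this
    simp only [smul_eq_mul] at this
    linarith
  rw [Real.norm_eq_abs, abs_le] at h1 h2 ⊢
  rw [map_neg] at h2
  constructor <;> linarith [h1.1, h1.2, h2.1, h2.2]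

end Pointwise

/-! ### Measurability, integrability and differentiation along boundary functions. -/

section Measurability

variable {n : ℕ} {φ : UnitCircle → Cn n → ℝ}

/-- The derivative is a pointwise limit of jointly measurable difference quotients with step
`1/(k+1)`. -/
lemma measurable_fderiv_apply_of_measurable
    (hmeas : Measurable fun x : UnitCircle × Cn n => φ x.1 x.2)
    (hdiff : ∀ s, Differentiable ℝ (φ s)) (v : Cn n) :
    Measurable fun x : UnitCircle × Cn n => fderiv ℝ (φ x.1) x.2 v := by
  have hlim : ∀ x : UnitCircle × Cn n, Filter.Tendsto (fun k : ℕ => ((k : ℝ) + 1) *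
      (φ x.1 (x.2 + ((k : ℝ) + 1)⁻¹ • v) - φ x.1 x.2)) Filter.atTop
      (nhds (fderiv ℝ (φ x.1) x.2 v)) := fun x => by
    have hd := (hdiff x.1 x.2).hasFDerivAt
    have h1 : Filter.Tendsto (fun k : ℕ => ((k : ℝ) + 1)) Filter.atTop Filter.atTop :=
      Filter.tendsto_atTop_add_const_right _ _ tendsto_natCast_atTop_atTop
    have := hd.lim v (c := fun k : ℕ => ((k : ℝ) + 1)) (l := Filter.atTop)
      (tendsto_norm_atTop_atTop.comp h1)
    simpa using this
  refine measurable_of_tendsto_metrizable (f := fun (k : ℕ) (x : UnitCircle × Cn n) =>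
    ((k : ℝ) + 1) * (φ x.1 (x.2 + ((k : ℝ) + 1)⁻¹ • v) - φ x.1 x.2)) (fun k => ?_)
    (tendsto_pi_nhds.mpr hlim)
  refine Measurable.const_mul (Measurable.sub ?_ hmeas) _
  exact hmeas.comp (measurable_fst.prodMk (measurable_snd.add_const _))

lemma measurable_complexGradient
    (hmeas : Measurable fun x : UnitCircle × Cn n => φ x.1 x.2)
    (hdiff : ∀ s, Differentiable ℝ (φ s)) :
    Measurable fun x : UnitCircle × Cn n => complexGradient (φ x.1) x.2 := by
  refine (WithLp.measurable_toLp 2 _).comp (measurable_pi_lambda _ fun j => ?_)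
  have h1 := measurable_fderiv_apply_of_measurable hmeas hdiff (EuclideanSpace.single j 1)
  have h2 := measurable_fderiv_apply_of_measurable hmeas hdiff (EuclideanSpace.single j Complex.I)
  exact (Complex.measurable_ofReal.comp h1).sub ((Complex.measurable_ofReal.comp h2).const_mul _)

lemma aestronglyMeasurable_comp {E : Type*} [NormedAddCommGroup E] [MeasurableSpace E]
    [BorelSpace E] [SecondCountableTopology E] {Φ : UnitCircle → Cn n → E}
    (hmeas : Measurable fun x : UnitCircle × Cn n => Φ x.1 x.2) {f : UnitCircle → Cn n}
    (hf : AEStronglyMeasurable f circleMeasure) :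
    AEStronglyMeasurable (fun s => Φ s (f s)) circleMeasure :=
  (hmeas.comp_aemeasurable (aemeasurable_id.prodMk hf.aemeasurable)).aestronglyMeasurable

lemma integrable_norm_add_rpow {p : ℝ} (hp : 1 < p) {f : UnitCircle → Cn n}
    (hf : MemLp f (ENNReal.ofReal p) circleMeasure) (a : ℝ) (ha : 0 ≤ a) :
    Integrable (fun s => (‖f s‖ + a) ^ p) circleMeasure := by
  have h : MemLp (fun s => ‖f s‖ + a) (ENNReal.ofReal p) circleMeasure :=
    hf.norm.add (memLp_const a)
  have := h.integrable_norm_rpow (by simp; linarith) ENNReal.ofReal_ne_top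
  refine this.congr (Filter.Eventually.of_forall fun s => ?_)
  simp only
  rw [Real.norm_of_nonneg (by positivity), ENNReal.toReal_ofReal (by linarith)]

lemma integrable_comp_of_growth {p c C A : ℝ} (hp : 1 < p) (hc : 0 < c) (hC : 0 < C)
    (hmeas : Measurable fun x : UnitCircle × Cn n => φ x.1 x.2)
    (hlo : ∀ s w, c * ‖w‖ ^ p - A ≤ φ s w) (hhi : ∀ s w, φ s w ≤ C * ‖w‖ ^ p + A)
    {f : UnitCircle → Cn n} (hf : MemLp f (ENNReal.ofReal p) circleMeasure) :
    Integrable (fun s => φ s (f s)) circleMeasure := by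
  have h1 : Integrable (fun s => C * (‖f s‖ + 0) ^ p + A) circleMeasure :=
    ((integrable_norm_add_rpow hp hf 0 le_rfl).const_mul C).add (integrable_const A)
  refine h1.mono' (aestronglyMeasurable_comp hmeas hf.1) (Filter.Eventually.of_forall fun s => ?_)
  have := hlo s (f s)
  have := hhi s (f s)
  have : 0 ≤ c * ‖f s‖ ^ p := by positivity
  have : 0 ≤ C * ‖f s‖ ^ p := by positivity
  rw [Real.norm_eq_abs, abs_le, add_zero]
  constructor <;> linarith

/-- The gradient has growth of order `p - 1`, and `(p - 1) q = p`. -/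
lemma memLp_complexGradient {p q c C A : ℝ} (hpq : p.HolderConjugate q) (hc : 0 < c)
    (hC : 0 < C) (hA : 0 < A) (hmeas : Measurable fun x : UnitCircle × Cn n => φ x.1 x.2)
    (hlo : ∀ s w, c * ‖w‖ ^ p - A ≤ φ s w) (hhi : ∀ s w, φ s w ≤ C * ‖w‖ ^ p + A)
    (hdiff : ∀ s, Differentiable ℝ (φ s)) (hconv : ∀ s, ConvexOn ℝ Set.univ (φ s))
    {f : UnitCircle → Cn n} (hf : MemLp f (ENNReal.ofReal p) circleMeasure) :
    MemLp (fun s => complexGradient (φ s) (f s)) (ENNReal.ofReal q) circleMeasure := by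
  have hq := hpq.symm.lt
  have hm : AEStronglyMeasurable (fun s => complexGradient (φ s) (f s)) circleMeasure :=
    aestronglyMeasurable_comp (measurable_complexGradient hmeas hdiff) hf.1
  have hq0 : ENNReal.ofReal q ≠ 0 := by simp; linarith
  rw [← integrable_norm_rpow_iff hm hq0 ENNReal.ofReal_ne_top,
    ENNReal.toReal_ofReal (by linarith)]
  set K := n * (2 * (C * 2 ^ p + 2 * A)) with hK
  have hK0 : 0 ≤ K := by positivity
  refine ((integrable_norm_add_rpow hpq.lt hf 1 zero_le_one).const_mul (K ^ q)).mono'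
    (hm.norm.aemeasurable.pow_const q).aestronglyMeasurable
    (Filter.Eventually.of_forall fun s => ?_)
  rw [Real.norm_of_nonneg (by positivity)]
  have h := norm_complexGradient_le_of_growth hpq.lt hc hC hA (hlo s) (hhi s) (hconv s) (hdiff s)
    (f s)
  calc _ ≤ (K * (‖f s‖ + 1) ^ (p - 1)) ^ q := by gcongr
    _ = K ^ q * (‖f s‖ + 1) ^ p := by
      rw [Real.mul_rpow hK0 (by positivity), ← Real.rpow_mul (by positivity), hpq.sub_one_mul_conj]

/-- Differentiation of the Poisson integral of `φ` along a perturbation of a boundary function. -/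
lemma hasFDerivAt_poissonExt {p c C A : ℝ} (hp : 1 < p) (hc : 0 < c)
    (hC : 0 < C) (hA : 0 < A) (hmeas : Measurable fun x : UnitCircle × Cn n => φ x.1 x.2)
    (hlo : ∀ s w, c * ‖w‖ ^ p - A ≤ φ s w) (hhi : ∀ s w, φ s w ≤ C * ‖w‖ ^ p + A)
    (hdiff : ∀ s, Differentiable ℝ (φ s)) (hconv : ∀ s, ConvexOn ℝ Set.univ (φ s))
    {f : UnitCircle → Cn n} (hf : MemLp f (ENNReal.ofReal p) circleMeasure)
    {m : UnitCircle → ℂ} (hm : Continuous m) {t : ℂ} (ht : t ∈ unitDisk)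
    (hgi : Integrable (fun s => complexGradient (φ s) (f s)) circleMeasure) :
    HasFDerivAt (fun x : Cn n => poissonExt (fun s => φ s (f s + m s • x)) t)
      (reDot n (poissonExt (fun s => m s • complexGradient (φ s) (f s)) t)) 0 := by
  obtain ⟨M, hM⟩ := (isCompact_range hm).isBounded.exists_norm_le
  have hM' : ∀ s, ‖m s‖ ≤ M := fun s => hM _ ⟨s, rfl⟩
  have hM0 : 0 ≤ M := (norm_nonneg _).trans (hM' (circlePoint 0))
  set K := n * (2 * (C * 2 ^ p + 2 * A)) with hK
  have hK0 : 0 ≤ K := by positivity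
  set Q := (1 + ‖t‖) / (1 - ‖t‖) with hQ
  have hfx : ∀ x : Cn n, MemLp (fun s => f s + m s • x) (ENNReal.ofReal p) circleMeasure :=
    fun x => hf.add (MemLp.of_bound (by fun_prop) (M * ‖x‖) (Filter.Eventually.of_forall fun s => by
      rw [norm_smul]; gcongr; exact hM' s))
  have hint : ∀ x : Cn n, Integrable (fun s : UnitCircle => poissonKernel 0 t (s : ℂ) • φ s (f s + m s • x))
      circleMeasure := fun x =>
    Integrable.poissonKernel_smul (integrable_comp_of_growth hp hc hC hmeas hlo hhi (hfx x)) ht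
  have hmg : Integrable (fun s => m s • complexGradient (φ s) (f s)) circleMeasure :=
    hgi.bdd_smul M hm.aestronglyMeasurable (Filter.Eventually.of_forall hM')
  have hmain := hasFDerivAt_integral_of_dominated_of_fderiv_le (μ := circleMeasure) (𝕜 := ℝ)
    (F := fun (x : Cn n) (s : UnitCircle) => poissonKernel 0 t (s : ℂ) • φ s (f s + m s • x))
    (F' := fun x (s : UnitCircle) => reDot n
      (poissonKernel 0 t (s : ℂ) • (m s • complexGradient (φ s) (f s + m s • x))))
    (bound := fun s => ‖reDot n‖ * (Q * (M * (K * (‖f s‖ + (M + 1)) ^ p))))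
    (x₀ := 0) (Metric.ball_mem_nhds 0 one_pos)
    (Filter.Eventually.of_forall fun x => (hint x).1) (hint 0) ?_ ?_ ?_ ?_
  · have e : ∫ s : UnitCircle, reDot n (poissonKernel 0 t (s : ℂ) •
        (m s • complexGradient (φ s) (f s + m s • (0 : Cn n)))) ∂circleMeasure
        = reDot n (poissonExt (fun s => m s • complexGradient (φ s) (f s)) t) := by
      simp only [smul_zero, add_zero]
      exact (reDot n).integral_comp_comm (Integrable.poissonKernel_smul hmg ht)
    rw [← e]
    exact hmain
  · simp only [smul_zero, add_zero]
    exact (reDot n).continuous.comp_aestronglyMeasurable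
      (Integrable.poissonKernel_smul hmg ht).1
  · refine Filter.Eventually.of_forall fun s x hx => ?_
    have hx1 : ‖x‖ ≤ 1 := (mem_ball_zero_iff.mp hx).le
    refine ((reDot n).le_opNorm _).trans ?_
    gcongr
    rw [norm_smul, norm_smul]
    have h1 := norm_complexGradient_le_of_growth hp hc hC hA (hlo s) (hhi s) (hconv s) (hdiff s)
      (f s + m s • x)
    have h2 : ‖f s + m s • x‖ ≤ ‖f s‖ + M := by
      refine (norm_add_le _ _).trans ?_
      rw [norm_smul]
      have := mul_le_mul (hM' s) hx1 (norm_nonneg _) hM0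
      linarith
    -- The base `‖f s‖ + (M + 1)` is at least one, so the exponent may be raised to `p`, where
    -- integrability comes directly from `f ∈ L^p`.
    have h3 : (‖f s + m s • x‖ + 1) ^ (p - 1) ≤ (‖f s‖ + (M + 1)) ^ p := by
      have hf0 := norm_nonneg (f s)
      calc _ ≤ (‖f s‖ + (M + 1)) ^ (p - 1) := by
            refine Real.rpow_le_rpow (by positivity) (by linarith) (by linarith)
        _ ≤ _ := Real.rpow_le_rpow_of_exponent_le (by linarith) (by linarith)
    have hQ0 : 0 ≤ Q := (norm_nonneg _).trans (norm_poissonKernel_le ht s)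
    refine mul_le_mul (norm_poissonKernel_le ht s) (mul_le_mul (hM' s) (h1.trans ?_)
      (norm_nonneg _) hM0) (by positivity) hQ0
    gcongr
  · exact ((((integrable_norm_add_rpow hp hf (M + 1) (by linarith)).const_mul K).const_mul
      M).const_mul Q).const_mul _
  · refine Filter.Eventually.of_forall fun s x _ => ?_
    have h1 : HasFDerivAt (fun x : Cn n => f s + m s • x)
        (m s • ContinuousLinearMap.id ℝ (Cn n)) x :=
      ((hasFDerivAt_id x).const_smul (m s)).const_add _
    have h2 := ((hdiff s (f s + m s • x)).hasFDerivAt.comp x h1).const_smul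
      (poissonKernel 0 t (s : ℂ))
    refine HasFDerivAt.congr_fderiv (f := fun x : Cn n =>
      poissonKernel 0 t (s : ℂ) • φ s (f s + m s • x)) h2 ?_
    ext v
    rw [fderiv_eq_reDot, map_smul]
    simp [dotC_smul_left, dotC_smul_right]

end Measurability

/-! ### Existence of minimizers for strictly convex integral functionals. -/

section Minimizer

variable {Ω E : Type*} [MeasurableSpace Ω] [NormedAddCommGroup E] [NormedSpace ℝ E]

/-- The midpoint convexity gap of `ψ` at `x`, `y`. -/
noncomputable def convexityGap (ψ : E → ℝ) (x y : E) : ℝ :=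
  (ψ x + ψ y) / 2 - ψ ((1 / 2 : ℝ) • x + (1 / 2 : ℝ) • y)

lemma convexityGap_pos {ψ : E → ℝ} (h : StrictConvexOn ℝ Set.univ ψ) {x y : E} (hxy : x ≠ y) :
    0 < convexityGap ψ x y := by
  have := h.2 (Set.mem_univ x) (Set.mem_univ y) hxy (by norm_num : (0 : ℝ) < 1 / 2)
    (by norm_num : (0 : ℝ) < 1 / 2) (by norm_num)
  simp only [smul_eq_mul] at this
  rw [convexityGap]
  linarith

lemma convexityGap_nonneg {ψ : E → ℝ} (h : StrictConvexOn ℝ Set.univ ψ) (x y : E) :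
    0 ≤ convexityGap ψ x y := by
  rcases eq_or_ne x y with rfl | hxy
  · have : (1 / 2 : ℝ) • x + (1 / 2 : ℝ) • x = x := by
      rw [← add_smul]; norm_num
    rw [convexityGap, this]
    linarith
  · exact (convexityGap_pos h hxy).le

lemma continuous_convexityGap {ψ : E → ℝ} (h : Continuous ψ) :
    Continuous fun z : E × E => convexityGap ψ z.1 z.2 := by
  unfold convexityGap
  fun_prop

/-- A pointwise bound of the distance of two vectors by their convexity gap. -/
lemma norm_sub_le_of_convexityGap {ψ : E → ℝ} (hψ : StrictConvexOn ℝ Set.univ ψ) {p R ε a : ℝ}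
    (hp : 1 < p) (hR : 0 < R) (hε : 0 < ε) (ha : 0 < a) {b : ℝ} (hb0 : 0 ≤ b) {x y : E}
    (h : ‖x‖ ≤ R → ‖y‖ ≤ R → ε ≤ ‖x - y‖ → b < 1 → a ≤ convexityGap ψ x y) :
    ‖x - y‖ ≤ ε + 2 * R * b + 2 * R / a * convexityGap ψ x y
      + 2 * R ^ (1 - p) * (‖x‖ ^ p + ‖y‖ ^ p) := by
  have h0 := convexityGap_nonneg hψ x y
  have h1 : 0 ≤ 2 * R * b := by positivity
  have h2 : 0 ≤ 2 * R / a * convexityGap ψ x y := by positivity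
  have hx0 : 0 ≤ ‖x‖ ^ p := by positivity
  have hy0 : 0 ≤ ‖y‖ ^ p := by positivity
  have h3 : 0 ≤ 2 * R ^ (1 - p) * (‖x‖ ^ p + ‖y‖ ^ p) := by positivity
  have hn := norm_sub_le x y
  have key : ∀ m : ℝ, R < m → m ≤ R ^ (1 - p) * m ^ p := fun m hm => by
    have hm0 : 0 < m := hR.trans hm
    have h4 : m ^ (1 - p) ≤ R ^ (1 - p) :=
      Real.rpow_le_rpow_of_nonpos hR hm.le (by linarith)
    calc m = m ^ (1 - p) * m ^ p := by rw [← Real.rpow_add hm0]; simp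
      _ ≤ _ := by gcongr
  have hRp : 0 ≤ R ^ (1 - p) := by positivity
  -- Each regime is absorbed by one term of the bound: a large vector by the `p`-th powers, close
  -- vectors by `ε`, then the gap term if `b < 1`, and `2 * R * b` otherwise. Later `b` is the
  -- indicator of an exceptional set.
  rcases lt_or_ge R (max ‖x‖ ‖y‖) with hm | hm
  · have h5 := key _ hm
    have h6 : max ‖x‖ ‖y‖ ^ p ≤ ‖x‖ ^ p + ‖y‖ ^ p := by
      rcases max_choice ‖x‖ ‖y‖ with h | h <;> rw [h] <;> linarith
    have h7 := mul_le_mul_of_nonneg_left h6 hRp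
    have h8 := le_max_left ‖x‖ ‖y‖
    have h9 := le_max_right ‖x‖ ‖y‖
    linarith
  · have hx := (le_max_left _ _).trans hm
    have hy := (le_max_right _ _).trans hm
    rcases lt_or_ge ‖x - y‖ ε with h4 | h4
    · linarith
    · rcases lt_or_ge b 1 with hb | hb
      · have h5 := h hx hy h4 hb
        have h6 : 2 * R ≤ 2 * R / a * convexityGap ψ x y := by
          rw [div_mul_eq_mul_div, le_div_iff₀ ha]
          gcongr
        linarith
      · have h6 : 2 * R * 1 ≤ 2 * R * b := by gcongr
        linarith

variable [FiniteDimensional ℝ E]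

/-- Away from a set of small measure, a measurable family of strictly convex functions is
uniformly strictly convex on bounded sets. -/
lemma exists_convexityGap_ge (μ : Measure Ω) [IsFiniteMeasure μ] {φ : Ω → E → ℝ}
    (hmeas : ∀ x, Measurable fun s => φ s x) (hcont : ∀ s, Continuous (φ s))
    (hconv : ∀ s, StrictConvexOn ℝ Set.univ (φ s)) (R : ℝ) {ε : ℝ} (hε : 0 < ε) {η : ENNReal}
    (hη : 0 < η) :
    ∃ a > 0, ∃ B, MeasurableSet B ∧ μ B ≤ η ∧ ∀ s ∉ B, ∀ x y, ‖x‖ ≤ R → ‖y‖ ≤ R → ε ≤ ‖x - y‖ →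
      a ≤ convexityGap (φ s) x y := by
  have : ProperSpace E := FiniteDimensional.proper_real E
  set D := TopologicalSpace.denseSeq (E × E) with hD
  -- The slack in `R + 1` and `ε / 2` gives an open set containing all pairs of interest, inside a
  -- compact set off the diagonal. Testing only a dense sequence in it keeps the exceptional sets
  -- measurable.
  set U : Set (E × E) := {z | ‖z.1‖ < R + 1 ∧ ‖z.2‖ < R + 1 ∧ ε / 2 < ‖z.1 - z.2‖} with hU
  have hUo : IsOpen U := by
    refine IsOpen.and ?_ (IsOpen.and ?_ ?_) <;> exact isOpen_lt (by fun_prop) (by fun_prop)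
  set K : Set (E × E) := {z | ‖z.1‖ ≤ R + 1 ∧ ‖z.2‖ ≤ R + 1 ∧ ε / 2 ≤ ‖z.1 - z.2‖} with hK
  have hKcl : IsClosed K := by
    refine IsClosed.and ?_ (IsClosed.and ?_ ?_) <;> exact isClosed_le (by fun_prop) (by fun_prop)
  have hKc : IsCompact K := by
    refine Metric.isCompact_of_isClosed_isBounded hKcl
      ((Metric.isBounded_closedBall (x := (0 : E × E)) (r := R + 1)).subset fun z hz => ?_)
    rw [mem_closedBall_zero_iff, Prod.norm_def]
    exact max_le hz.1 hz.2.1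
  set B : ℕ → Set Ω := fun j => ⋃ i, ⋃ (_ : D i ∈ U),
    {s | convexityGap (φ s) (D i).1 (D i).2 < ((j : ℝ) + 1)⁻¹} with hB
  have hBm : ∀ j, MeasurableSet (B j) := fun j => by
    refine MeasurableSet.iUnion fun i => MeasurableSet.iUnion fun _ =>
      measurableSet_lt ?_ measurable_const
    unfold convexityGap
    exact (((hmeas _).add (hmeas _)).div_const 2).sub (hmeas _)
  have hanti : Antitone B := fun j k hjk s hs => by
    simp only [hB, Set.mem_iUnion, Set.mem_ofPred_eq] at hs ⊢
    obtain ⟨i, hi, hs⟩ := hs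
    refine ⟨i, hi, hs.trans_le ?_⟩
    gcongr
  -- For fixed `s` the gap has a positive minimum on the compact set, so `s` lies outside `B j` for
  -- large `j`. Continuity of the measure from above then makes some `B j` small.
  have hempty : ⋂ j, B j = ∅ := by
    refine Set.eq_empty_of_forall_notMem fun s hs => ?_
    rw [Set.mem_iInter] at hs
    obtain ⟨i₀, hi₀, -⟩ : ∃ i, ∃ (_ : D i ∈ U),
        convexityGap (φ s) (D i).1 (D i).2 < (((0 : ℕ) : ℝ) + 1)⁻¹ := by
      simpa [hB] using hs 0
    have hUK : ∀ z ∈ U, z ∈ K := fun z hz => ⟨hz.1.le, hz.2.1.le, hz.2.2.le⟩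
    obtain ⟨z, hz, hmin⟩ := hKc.exists_isMinOn ⟨_, hUK _ hi₀⟩
      (continuous_convexityGap (hcont s)).continuousOn
    have hzpos : 0 < convexityGap (φ s) z.1 z.2 := convexityGap_pos (hconv s) fun h => by
      have := hz.2.2
      rw [h, sub_self, norm_zero] at this
      linarith
    obtain ⟨j, hj⟩ := exists_nat_one_div_lt hzpos
    have := hs j
    simp only [hB, Set.mem_iUnion, Set.mem_ofPred_eq] at this
    obtain ⟨i, hi, hlt⟩ := this
    have h2 := isMinOn_iff.mp hmin _ (hUK _ hi)
    rw [one_div] at hj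
    linarith
  have hlim := tendsto_measure_iInter_atTop (μ := μ) (fun j => (hBm j).nullMeasurableSet) hanti
    ⟨0, measure_ne_top _ _⟩
  rw [hempty, measure_empty] at hlim
  obtain ⟨j, hj⟩ := (hlim.eventually (gt_mem_nhds hη)).exists
  refine ⟨((j : ℝ) + 1)⁻¹, by positivity, B j, hBm j, hj.le, fun s hs x y hx hy hxy => ?_⟩
  by_contra hlt
  push Not at hlt
  -- The pairs violating the bound form an open set; if it is nonempty it contains some `D i`, which
  -- would put `s` into `B j`.
  have hopen : IsOpen (U ∩ {z | convexityGap (φ s) z.1 z.2 < ((j : ℝ) + 1)⁻¹}) :=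
    hUo.inter (isOpen_lt (continuous_convexityGap (hcont s)) continuous_const)
  obtain ⟨z, hz, i, rfl⟩ := (TopologicalSpace.denseRange_denseSeq (E × E)).inter_open_nonempty _ hopen
    ⟨(x, y), ⟨by simp only; linarith, by simp only; linarith, by simp only; linarith⟩, hlt⟩
  apply hs
  simp only [hB, Set.mem_iUnion, Set.mem_ofPred_eq]
  exact ⟨i, hz.1, hz.2⟩

/-- A minimizing sequence of a strictly convex integral functional is a Cauchy sequence in `L¹`. -/
lemma cauchy_of_minimizing (μ : Measure Ω) [IsFiniteMeasure μ] {φ : Ω → E → ℝ} {p B₀ : ℝ}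
    (hp : 1 < p) (hmeas : ∀ x, Measurable fun s => φ s x) (hcont : ∀ s, Continuous (φ s))
    (hconv : ∀ s, StrictConvexOn ℝ Set.univ (φ s)) {u : ℕ → Ω → E}
    (hu : ∀ k, Integrable (u k) μ) (hup : ∀ k, Integrable (fun s => ‖u k s‖ ^ p) μ)
    (hB : ∀ k, ∫ s, ‖u k s‖ ^ p ∂μ ≤ B₀)
    (hgap : ∀ k l, Integrable (fun s => convexityGap (φ s) (u k s) (u l s)) μ)
    (hgap2 : ∀ e > 0, ∃ N, ∀ k ≥ N, ∀ l ≥ N,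
      ∫ s, convexityGap (φ s) (u k s) (u l s) ∂μ ≤ e) {e : ℝ} (he : 0 < e) :
    ∃ N, ∀ k ≥ N, ∀ l ≥ N, ∫ s, ‖u k s - u l s‖ ∂μ ≤ e := by
  have hB0 : 0 ≤ B₀ := (integral_nonneg fun s => by positivity).trans (hB 0)
  -- The order of choices matters: `R` from the `p`-th moments (using `p > 1`), then `ε` and `η`,
  -- then `a`, which depends on all three, and finally `N`. Each controls one quarter of `e`.
  obtain ⟨R, hR, hRe⟩ : ∃ R : ℝ, 0 < R ∧ 2 * R ^ (1 - p) * (B₀ + B₀) < e / 4 := by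
    have h1 : Filter.Tendsto (fun R : ℝ => 2 * R ^ (1 - p) * (B₀ + B₀)) Filter.atTop (nhds 0) := by
      have h := tendsto_rpow_neg_atTop (y := p - 1) (by linarith)
      simp only [neg_sub] at h
      simpa using (h.const_mul 2).mul_const (B₀ + B₀)
    have h2 := h1.eventually (gt_mem_nhds (by positivity : (0 : ℝ) < e / 4))
    obtain ⟨R, hR1, hR2⟩ := (h2.and (Filter.eventually_gt_atTop 0)).exists
    exact ⟨R, hR2, hR1⟩
  set m := μ.real Set.univ with hm
  have hm0 : 0 ≤ m := measureReal_nonneg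
  obtain ⟨ε, hε, hεe⟩ : ∃ ε : ℝ, 0 < ε ∧ ε * m ≤ e / 4 := by
    refine ⟨e / 4 / (m + 1), by positivity, ?_⟩
    rw [div_mul_eq_mul_div, div_le_iff₀ (by positivity)]
    nlinarith
  set η : ℝ := e / 4 / (2 * R) with hη
  have hη0 : 0 < η := by positivity
  obtain ⟨a, ha, B, hBm, hBη, hBa⟩ := exists_convexityGap_ge μ hmeas hcont hconv R hε
    (η := ENNReal.ofReal η) (by simpa using hη0)
  obtain ⟨N, hN⟩ := hgap2 (e / 4 / (2 * R / a)) (by positivity)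
  refine ⟨N, fun k hk l hl => ?_⟩
  have hind : Integrable (B.indicator (fun _ => (1 : ℝ))) μ :=
    (integrable_const 1).indicator hBm
  have hi1 : Integrable (fun s => ε + 2 * R * B.indicator (fun _ => (1 : ℝ)) s) μ :=
    (integrable_const ε).add (hind.const_mul _)
  have hi2 : Integrable (fun s => ε + 2 * R * B.indicator (fun _ => (1 : ℝ)) s
      + 2 * R / a * convexityGap (φ s) (u k s) (u l s)) μ := hi1.add ((hgap k l).const_mul _)
  have hi3 : Integrable (fun s => 2 * R ^ (1 - p) * (‖u k s‖ ^ p + ‖u l s‖ ^ p)) μ :=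
    ((hup k).add (hup l)).const_mul _
  have hBr : μ.real B ≤ η := ENNReal.toReal_le_of_le_ofReal hη0.le hBη
  calc ∫ s, ‖u k s - u l s‖ ∂μ
      ≤ ∫ s, (ε + 2 * R * B.indicator (fun _ => (1 : ℝ)) s
        + 2 * R / a * convexityGap (φ s) (u k s) (u l s)
        + 2 * R ^ (1 - p) * (‖u k s‖ ^ p + ‖u l s‖ ^ p)) ∂μ := by
        refine integral_mono ((hu k).sub (hu l)).norm (hi2.add hi3) fun s => ?_
        refine norm_sub_le_of_convexityGap (hconv s) hp hR hε ha
          (Set.indicator_nonneg (fun _ _ => zero_le_one) s) fun hx hy hxy hb => ?_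
        refine hBa s (fun hs => ?_) _ _ hx hy hxy
        rw [Set.indicator_of_mem hs] at hb
        exact lt_irrefl _ hb
    _ = ε * m + 2 * R * μ.real B + 2 * R / a * ∫ s, convexityGap (φ s) (u k s) (u l s) ∂μ
        + 2 * R ^ (1 - p) * (∫ s, ‖u k s‖ ^ p ∂μ + ∫ s, ‖u l s‖ ^ p ∂μ) := by
        rw [integral_add hi2 hi3, integral_add hi1 ((hgap k l).const_mul _),
          integral_add (integrable_const ε) (hind.const_mul _), integral_const_mul,
          integral_const_mul, integral_const_mul, integral_add (hup k) (hup l),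
          integral_indicator_const _ hBm, integral_const]
        simp [hm, mul_comm]
    _ ≤ e / 4 + e / 4 + e / 4 + e / 4 := by
        have h1 : 2 * R * μ.real B ≤ e / 4 := by
          calc _ ≤ 2 * R * η := by gcongr
            _ = e / 4 := by rw [hη]; field_simp
        have h2 : 2 * R / a * ∫ s, convexityGap (φ s) (u k s) (u l s) ∂μ ≤ e / 4 := by
          calc _ ≤ 2 * R / a * (e / 4 / (2 * R / a)) := by gcongr; exact hN k hk l hl
            _ = e / 4 := by field_simp
        have h3 : 2 * R ^ (1 - p) * (∫ s, ‖u k s‖ ^ p ∂μ + ∫ s, ‖u l s‖ ^ p ∂μ) ≤ e / 4 := by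
          refine le_trans ?_ hRe.le
          gcongr
          · exact hB k
          · exact hB l
        linarith
    _ = e := by ring

variable [MeasurableSpace E] [BorelSpace E]

/-- Direct method: a strictly convex integral functional of `p`-growth attains its minimum on a
midpoint convex set of functions that is closed under `L¹` limits in `L^p`. -/
theorem exists_integral_minimizer (μ : Measure Ω) [IsFiniteMeasure μ] {φ : Ω → E → ℝ} {p c A : ℝ}
    (hp : 1 < p) (hc : 0 < c) (hmeas : Measurable fun x : Ω × E => φ x.1 x.2)
    (hcont : ∀ s, Continuous (φ s)) (hconv : ∀ s, StrictConvexOn ℝ Set.univ (φ s))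
    (hlo : ∀ s w, c * ‖w‖ ^ p - A ≤ φ s w) {S : Set (Ω → E)} (hne : S.Nonempty)
    (hmem : ∀ f ∈ S, MemLp f (ENNReal.ofReal p) μ) (hint : ∀ f ∈ S, Integrable (fun s => φ s (f s)) μ)
    (hmid : ∀ f ∈ S, ∀ g ∈ S, (fun s => (1 / 2 : ℝ) • f s + (1 / 2 : ℝ) • g s) ∈ S)
    (hclosed : ∀ (u : ℕ → Ω → E) (f : Ω → E), (∀ k, u k ∈ S) → MemLp f (ENNReal.ofReal p) μ →
      Filter.Tendsto (fun k => eLpNorm (u k - f) 1 μ) Filter.atTop (nhds 0) → f ∈ S) :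
    ∃ f ∈ S, ∀ g ∈ S, ∫ s, φ s (f s) ∂μ ≤ ∫ s, φ s (g s) ∂μ := by
  have hp1 : (1 : ENNReal) ≤ ENNReal.ofReal p := by simpa using hp.le
  have hp0 : ENNReal.ofReal p ≠ 0 := (zero_lt_one.trans_le hp1).ne'
  have hpr : (ENNReal.ofReal p).toReal = p := ENNReal.toReal_ofReal (by linarith)
  set J : (Ω → E) → ℝ := fun f => ∫ s, φ s (f s) ∂μ with hJ
  set m := μ.real Set.univ with hm
  have hpow : ∀ f ∈ S, Integrable (fun s => ‖f s‖ ^ p) μ := fun f hf => by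
    have := (hmem f hf).integrable_norm_rpow hp0 ENNReal.ofReal_ne_top
    rwa [hpr] at this
  have hJlo : ∀ f ∈ S, c * ∫ s, ‖f s‖ ^ p ∂μ ≤ J f + A * m := fun f hf => by
    have h1 : ∫ s, (c * ‖f s‖ ^ p - A) ∂μ ≤ J f :=
      integral_mono (((hpow f hf).const_mul c).sub (integrable_const A)) (hint f hf)
        fun s => hlo s (f s)
    rw [integral_sub ((hpow f hf).const_mul c) (integrable_const A), integral_const_mul,
      integral_const, smul_eq_mul] at h1
    linarith
  have hJ0 : ∀ f ∈ S, 0 ≤ J f + A * m := fun f hf =>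
    (mul_nonneg hc.le (integral_nonneg fun s => by positivity)).trans (hJlo f hf)
  have hbdd : BddBelow (J '' S) := ⟨-(A * m), by
    rintro _ ⟨f, hf, rfl⟩
    linarith [hJ0 f hf]⟩
  set I := sInf (J '' S) with hI
  have hIle : ∀ f ∈ S, I ≤ J f := fun f hf => csInf_le hbdd ⟨f, hf, rfl⟩
  have hseq : ∀ k : ℕ, ∃ f ∈ S, J f < I + 1 / ((k : ℝ) + 1) := fun k => by
    obtain ⟨_, ⟨f, hf, rfl⟩, h⟩ := exists_lt_of_csInf_lt (hne.image J)
      (lt_add_of_pos_right I (by positivity : (0 : ℝ) < 1 / ((k : ℝ) + 1)))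
    exact ⟨f, hf, h⟩
  choose u huS huJ using hseq
  have huJlim : Filter.Tendsto (fun k => J (u k)) Filter.atTop (nhds I) := by
    refine tendsto_of_tendsto_of_tendsto_of_le_of_le tendsto_const_nhds ?_
      (fun k => hIle _ (huS k)) (fun k => (huJ k).le)
    simpa using tendsto_one_div_add_atTop_nhds_zero_nat.const_add I
  have hui : ∀ k, Integrable (u k) μ := fun k => (hmem _ (huS k)).integrable hp1
  have hgi : ∀ k l, Integrable (fun s => convexityGap (φ s) (u k s) (u l s)) μ := fun k l =>
    (((hint _ (huS k)).add (hint _ (huS l))).div_const 2).sub (hint _ (hmid _ (huS k) _ (huS l)))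
  -- The midpoint of two members of `S` is again in `S`, so its value is at least the infimum.
  have hgap : ∀ k l, ∫ s, convexityGap (φ s) (u k s) (u l s) ∂μ ≤ (J (u k) + J (u l)) / 2 - I :=
    fun k l => by
      have h1 : ∫ s, convexityGap (φ s) (u k s) (u l s) ∂μ = (J (u k) + J (u l)) / 2 -
          J (fun s => (1 / 2 : ℝ) • u k s + (1 / 2 : ℝ) • u l s) := by
        simp only [convexityGap, hJ]
        rw [← integral_add (hint _ (huS k)) (hint _ (huS l)), ← integral_div]
        exact integral_sub (((hint _ (huS k)).add (hint _ (huS l))).div_const 2)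
          (hint _ (hmid _ (huS k) _ (huS l)))
      rw [h1]
      linarith [hIle _ (hmid _ (huS k) _ (huS l))]
  have hcau : ∀ e > 0, ∃ N, ∀ k ≥ N, ∀ l ≥ N, ∫ s, ‖u k s - u l s‖ ∂μ ≤ e := fun e he => by
    refine cauchy_of_minimizing μ hp (fun x => hmeas.comp (measurable_id.prodMk measurable_const))
      hcont hconv hui (fun k => hpow _ (huS k)) (B₀ := (I + 1 + A * m) / c) (fun k => ?_) hgi
      (fun e he => ?_) he
    · rw [le_div_iff₀' hc]
      have h1 := hJlo _ (huS k)
      have h2 := huJ k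
      have h3 : 1 / ((k : ℝ) + 1) ≤ 1 := by
        rw [div_le_one (by positivity)]
        have : (0 : ℝ) ≤ k := by positivity
        linarith
      linarith
    · have hev := huJlim.eventually (gt_mem_nhds (lt_add_of_pos_right I he))
      obtain ⟨N, hN⟩ := Filter.eventually_atTop.mp hev
      refine ⟨N, fun k hk l hl => (hgap k l).trans ?_⟩
      linarith [hN k hk, hN l hl]
  have hm1 : ∀ k, MemLp (u k) 1 μ := fun k => memLp_one_iff_integrable.mpr (hui k)
  have hcs : CauchySeq fun k => (hm1 k).toLp (u k) := by
    rw [EMetric.cauchySeq_iff]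
    intro ε hε
    obtain ⟨e, he0, heε⟩ := ENNReal.lt_iff_exists_nnreal_btwn.mp hε
    obtain ⟨N, hN⟩ := hcau e (by simpa using he0)
    refine ⟨N, fun k hk l hl => lt_of_le_of_lt ?_ heε⟩
    rw [Lp.edist_toLp_toLp, eLpNorm_one_eq_lintegral_enorm]
    have h1 := hN k hk l hl
    have h2 := ofReal_integral_norm_eq_lintegral_enorm ((hui k).sub (hui l))
    rw [← h2]
    simpa using ENNReal.ofReal_le_ofReal h1
  obtain ⟨f', hf'⟩ := cauchySeq_tendsto_of_complete hcs
  set f : Ω → E := ⇑f' with hf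
  have hfm : AEStronglyMeasurable f μ := (Lp.memLp f').1
  have hlim1 : Filter.Tendsto (fun k => eLpNorm (u k - f) 1 μ) Filter.atTop (nhds 0) := by
    have := (Lp.tendsto_Lp_iff_tendsto_eLpNorm' _ _).mp hf'
    refine this.congr fun k => eLpNorm_congr_ae ?_
    exact ((hm1 k).coeFn_toLp).sub (ae_eq_refl _)
  obtain ⟨ns, hns, hae⟩ := (tendstoInMeasure_of_tendsto_eLpNorm one_ne_zero (fun k => (hm1 k).1)
    hfm hlim1).exists_seq_tendsto_ae
  have hφf : AEStronglyMeasurable (fun s => φ s (f s)) μ :=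
    (hmeas.comp_aemeasurable (aemeasurable_id.prodMk hfm.aemeasurable)).aestronglyMeasurable
  have hpos : ∀ s w, 0 ≤ φ s w + A := fun s w => by
    have h1 := hlo s w
    have h2 : 0 ≤ c * ‖w‖ ^ p := by positivity
    linarith
  have hJA : ∀ g, Integrable (fun s => φ s (g s)) μ →
      ∫⁻ s, ENNReal.ofReal (φ s (g s) + A) ∂μ = ENNReal.ofReal (J g + A * m) := fun g hg => by
    have hgA : Integrable (fun s => φ s (g s) + A) μ := hg.add (integrable_const A)
    rw [← ofReal_integral_eq_lintegral_ofReal hgA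
      (Filter.Eventually.of_forall fun s => hpos s (g s)), integral_add hg (integrable_const A),
      integral_const, smul_eq_mul, mul_comm]
  -- Lower semicontinuity along an a.e. convergent subsequence; adding `A` makes the integrand
  -- nonnegative, as Fatou's lemma requires.
  have hfatou : ∫⁻ s, ENNReal.ofReal (φ s (f s) + A) ∂μ ≤ ENNReal.ofReal (I + A * m) := by
    calc ∫⁻ s, ENNReal.ofReal (φ s (f s) + A) ∂μ
        = ∫⁻ s, Filter.liminf (fun k => ENNReal.ofReal (φ s (u (ns k) s) + A)) Filter.atTop ∂μ := by
          refine lintegral_congr_ae ?_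
          filter_upwards [hae] with s hs
          have h1 : Filter.Tendsto (fun k => ENNReal.ofReal (φ s (u (ns k) s) + A)) Filter.atTop
              (nhds (ENNReal.ofReal (φ s (f s) + A))) :=
            ENNReal.tendsto_ofReal ((((hcont s).tendsto _).comp hs).add_const A)
          exact h1.liminf_eq.symm
      _ ≤ Filter.liminf (fun k => ∫⁻ s, ENNReal.ofReal (φ s (u (ns k) s) + A) ∂μ) Filter.atTop :=
          lintegral_liminf_le' fun k =>
            ((hint _ (huS (ns k))).aestronglyMeasurable.aemeasurable.add_const A).ennreal_ofReal
      _ = ENNReal.ofReal (I + A * m) := by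
          have h1 : ∀ k, ∫⁻ s, ENNReal.ofReal (φ s (u (ns k) s) + A) ∂μ
              = ENNReal.ofReal (J (u (ns k)) + A * m) := fun k => hJA _ (hint _ (huS (ns k)))
          simp only [h1]
          exact (ENNReal.tendsto_ofReal
            ((huJlim.comp hns.tendsto_atTop).add_const (A * m))).liminf_eq
  have hfA : Integrable (fun s => φ s (f s) + A) μ := by
    refine ⟨hφf.add aestronglyMeasurable_const, ?_⟩
    rw [hasFiniteIntegral_iff_ofReal (Filter.Eventually.of_forall fun s => hpos s (f s))]
    exact hfatou.trans_lt ENNReal.ofReal_lt_top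
  have hfi : Integrable (fun s => φ s (f s)) μ := by
    exact (hfA.sub (integrable_const A)).congr (Filter.Eventually.of_forall fun s => by simp)
  -- The sequence converges only in `L¹`; coercivity of `φ` puts the limit back in `L^p`.
  have hfp : MemLp f (ENNReal.ofReal p) μ := by
    rw [← integrable_norm_rpow_iff hfm hp0 ENNReal.ofReal_ne_top, hpr]
    refine (hfA.const_mul c⁻¹).mono' (hfm.norm.aemeasurable.pow_const p).aestronglyMeasurable
      (Filter.Eventually.of_forall fun s => ?_)
    rw [Real.norm_of_nonneg (by positivity), inv_mul_eq_div, le_div_iff₀' hc]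
    linarith [hlo s (f s)]
  have hfS : f ∈ S := hclosed u f huS hfp hlim1
  refine ⟨f, hfS, fun g hg => ?_⟩
  rw [hJA f hfi] at hfatou
  have hI0 : 0 ≤ I + A * m := by
    have : -(A * m) ≤ I := le_csInf (hne.image J) (by
      rintro _ ⟨f, hf, rfl⟩
      linarith [hJ0 f hf])
    linarith
  have := (ENNReal.ofReal_le_ofReal_iff hI0).mp hfatou
  have := hIle g hg
  simp only [hJ] at *
  linarith

end Minimizer

/-! ### Leaves, regularity of the interpolant and its gradient. -/

section Leaves

variable {n : ℕ}

lemma IsHardy.poissonExt {r : ℝ} {F : ℂ → Cn n} {f : UnitCircle → Cn n} (h : IsHardy r F f) :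
    IsHardy r (poissonExt f) f :=
  ⟨h.memLp, h.holomorphic.congr fun t ht => (h.eq_poissonExt t ht).symm, fun _ _ => rfl⟩

lemma tendsto_integral_smul {u : ℕ → UnitCircle → Cn n} {f : UnitCircle → Cn n}
    (hu : ∀ k, Integrable (u k) circleMeasure) (hf : Integrable f circleMeasure)
    (hlim : Filter.Tendsto (fun k => eLpNorm (u k - f) 1 circleMeasure) Filter.atTop (nhds 0))
    {m : UnitCircle → ℂ} (hm : Continuous m) :
    Filter.Tendsto (fun k => ∫ s, m s • u k s ∂circleMeasure) Filter.atTop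
      (nhds (∫ s, m s • f s ∂circleMeasure)) := by
  obtain ⟨M, hM⟩ := (isCompact_range hm).isBounded.exists_norm_le
  have hM' : ∀ s, ‖m s‖ ≤ M := fun s => hM _ ⟨s, rfl⟩
  have hint : ∀ {g : UnitCircle → Cn n}, Integrable g circleMeasure →
      Integrable (fun s => m s • g s) circleMeasure := fun hg =>
    hg.bdd_smul M hm.aestronglyMeasurable (Filter.Eventually.of_forall hM')
  refine tendsto_integral_of_L1' _ (hint hf).1
    (Filter.Eventually.of_forall fun k => hint (hu k)) ?_
  have h0 : Filter.Tendsto (fun k => ENNReal.ofReal M * eLpNorm (u k - f) 1 circleMeasure)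
      Filter.atTop (nhds 0) := by
    simpa using ENNReal.Tendsto.const_mul hlim (Or.inr ENNReal.ofReal_ne_top)
  refine tendsto_of_tendsto_of_tendsto_of_le_of_le tendsto_const_nhds h0
    (fun _ => zero_le) fun k => ?_
  refine eLpNorm_le_mul_eLpNorm_of_ae_le_mul (Filter.Eventually.of_forall fun s => ?_) 1
  simp only [Pi.sub_apply, ← smul_sub, norm_smul]
  gcongr
  exact hM' s

lemma integral_pow_smul_apply {f : UnitCircle → Cn n} (hf : Integrable f circleMeasure)
    (k : ℕ) (j : Fin n) :
    (∫ s : UnitCircle, (s : ℂ) ^ k • f s ∂circleMeasure) j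
      = ∫ s : UnitCircle, (s : ℂ) ^ k * f s j ∂circleMeasure := by
  have hint : Integrable (fun s : UnitCircle => (s : ℂ) ^ k • f s) circleMeasure :=
    Integrable.bdd_smul (φ := fun s : UnitCircle => (s : ℂ) ^ k) hf 1
      (Continuous.aestronglyMeasurable (by fun_prop))
      (Filter.Eventually.of_forall fun s => by simp)
  have h := (EuclideanSpace.proj j : Cn n →L[ℂ] ℂ).integral_comp_comm hint
  simp only [PiLp.proj_apply, PiLp.smul_apply, smul_eq_mul] at h
  exact h.symm

/-- The moments are continuous in the `L¹` norm, so their vanishing passes to the limit. -/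
lemma IsHardy.of_tendsto {r : ℝ} (hr : 1 ≤ r) {u : ℕ → UnitCircle → Cn n}
    {f : UnitCircle → Cn n} {U : ℕ → ℂ → Cn n} (hu : ∀ k, IsHardy r (U k) (u k))
    (hf : MemLp f (ENNReal.ofReal r) circleMeasure)
    (hlim : Filter.Tendsto (fun k => eLpNorm (u k - f) 1 circleMeasure) Filter.atTop (nhds 0)) :
    IsHardy r (DualFoliation.poissonExt f) f := by
  have hfi : Integrable f circleMeasure := hf.integrable (by simpa using hr)
  have hui := fun k => (hu k).integrable hr
  refine isHardy_of_momentsVanish hr hf (fun j k => ?_) fun _ _ => rfl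
  have h := tendsto_integral_smul hui hfi hlim (m := fun s => (s : ℂ) ^ (k + 1)) (by fun_prop)
  have h2 : Filter.Tendsto (fun i => (∫ s : UnitCircle, (s : ℂ) ^ (k + 1) • u i s ∂circleMeasure) j)
      Filter.atTop (nhds ((∫ s : UnitCircle, (s : ℂ) ^ (k + 1) • f s ∂circleMeasure) j)) :=
    ((EuclideanSpace.proj j : Cn n →L[ℂ] ℂ).continuous.tendsto _).comp h
  simp only [integral_pow_smul_apply (hui _), integral_pow_smul_apply hfi] at h2
  have h3 : ∀ i, ∫ s : UnitCircle, (s : ℂ) ^ (k + 1) * u i s j ∂circleMeasure = 0 :=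
    fun i => (hu i).momentsVanish hr j k
  simp only [h3] at h2
  exact tendsto_nhds_unique h2 tendsto_const_nhds

lemma poissonExt_of_tendsto {u : ℕ → UnitCircle → Cn n} {f : UnitCircle → Cn n}
    (hu : ∀ k, Integrable (u k) circleMeasure) (hf : Integrable f circleMeasure)
    (hlim : Filter.Tendsto (fun k => eLpNorm (u k - f) 1 circleMeasure) Filter.atTop (nhds 0))
    {t : ℂ} (ht : t ∈ unitDisk) {w : Cn n} (hw : ∀ k, poissonExt (u k) t = w) :
    poissonExt f t = w := by
  have h := tendsto_integral_smul hu hf hlim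
    (m := fun s : UnitCircle => (poissonKernel 0 t (s : ℂ) : ℂ))
    (Complex.continuous_ofReal.comp (continuous_poissonKernel ht))
  simp only [Complex.coe_smul] at h
  exact tendsto_nhds_unique h (tendsto_const_nhds.congr fun k => (hw k).symm)

lemma poissonExt_smul_apply {g : UnitCircle → Cn n} (hg : Integrable g circleMeasure)
    {m : UnitCircle → ℂ} (hm : Continuous m) {t : ℂ} (ht : t ∈ unitDisk) (j : Fin n) :
    poissonExt (fun s => m s • g s) t j = poissonExt (fun s => m s * g s j) t := by
  obtain ⟨M, hM⟩ := (isCompact_range hm).isBounded.exists_norm_le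
  exact poissonExt_apply (hg.bdd_smul M hm.aestronglyMeasurable
    (Filter.Eventually.of_forall fun s => hM _ ⟨s, rfl⟩)) ht j

variable {p q c C A : ℝ} {φ : UnitCircle → Cn n → ℝ}

/-- The zero function with `f₀ = A` competes, because `φ s ≥ -A` bounds the conjugate at `0` by `A`.
-/
lemma interpolantSet_nonempty (hq : 1 ≤ q) (hc : 0 < c)
    (hlo : ∀ s w, c * ‖w‖ ^ p - A ≤ φ s w) (t : ℂ) (w : Cn n) :
    (interpolantSet q φ t w).Nonempty := by
  refine ⟨_, fun _ => (A : ℂ), fun t => (1 : Polynomial ℂ).eval t • (0 : Cn n),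
    fun s => (1 : Polynomial ℂ).eval (s : ℂ) • (0 : Cn n), memLp_const _,
    isHardy_polynomial hq 1 0, Filter.Eventually.of_forall fun s => ?_, rfl⟩
  refine ciSup_le fun v => ?_
  have h1 := hlo s v
  have h2 : 0 ≤ c * ‖v‖ ^ p := by positivity
  simp [dotC]
  linarith

lemma interpolant_le_of_isHardy (hpq : p.HolderConjugate q) (hc : 0 < c) (hC : 0 < C)
    (hmeas : Measurable fun x : UnitCircle × Cn n => φ x.1 x.2)
    (hlo : ∀ s w, c * ‖w‖ ^ p - A ≤ φ s w) (hhi : ∀ s w, φ s w ≤ C * ‖w‖ ^ p + A)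
    {F : ℂ → Cn n} {f : UnitCircle → Cn n} (hF : IsHardy p F f) {t : ℂ} (ht : t ∈ unitDisk) :
    interpolant p φ t (F t) ≤ poissonExt (fun s => φ s (f s)) t :=
  interpolant_le_poissonExt hpq hF (integrable_comp_of_growth hpq.lt hc hC hmeas hlo hhi hF.memLp)
    (fun s z => re_dotC_le_legendre_add (bddAbove_legendre hpq.lt hc (hlo s) z) (f s)) ht
    (interpolantSet_nonempty hpq.symm.lt.le hc hlo t (F t))

/-- Among the Hardy functions with a prescribed value at `t` there is one that minimizes the
Poisson integral of the boundary data. -/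
lemma exists_isHardy_minimizer (hp : 1 < p) (hc : 0 < c) (hC : 0 < C) (hA : 0 < A)
    (hmeas : Measurable fun x : UnitCircle × Cn n => φ x.1 x.2)
    (hlo : ∀ s w, c * ‖w‖ ^ p - A ≤ φ s w) (hhi : ∀ s w, φ s w ≤ C * ‖w‖ ^ p + A)
    (hcont : ∀ s, Continuous (φ s)) (hconv : ∀ s, StrictConvexOn ℝ Set.univ (φ s))
    {t : ℂ} (ht : t ∈ unitDisk) (w : Cn n) :
    ∃ F f, IsHardy p F f ∧ F t = w ∧ ∀ G g, IsHardy p G g → G t = w →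
      poissonExt (fun s => φ s (f s)) t ≤ poissonExt (fun s => φ s (g s)) t := by
  set S : Set (UnitCircle → Cn n) := {f | IsHardy p (poissonExt f) f ∧ poissonExt f t = w} with hS
  have hSne : S.Nonempty := by
    refine ⟨_, (isHardy_polynomial hp.le 1 w).poissonExt, ?_⟩
    rw [← (isHardy_polynomial hp.le 1 w).eq_poissonExt t ht]
    simp
  have hlow := poissonLower_pos ht
  -- The Harnack bounds of the Poisson kernel: weighting `φ` by the kernel preserves the lower
  -- growth condition with constants `a * c` and `b * A`.
  set a := (1 - ‖t‖) / (1 + ‖t‖) with ha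
  set b := (1 + ‖t‖) / (1 - ‖t‖) with hb
  have hconv' : ∀ s : UnitCircle,
      StrictConvexOn ℝ Set.univ fun x => poissonKernel 0 t (s : ℂ) * φ s x := fun s => by
    refine ⟨convex_univ, fun x _ y _ hxy α β hα hβ hαβ => ?_⟩
    have h1 := (hconv s).2 (Set.mem_univ x) (Set.mem_univ y) hxy hα hβ hαβ
    have h2 := mul_lt_mul_of_pos_left h1 (poissonKernel_pos ht s)
    simp only [smul_eq_mul] at h2 ⊢
    linarith
  have hlo' : ∀ (s : UnitCircle) x, a * c * ‖x‖ ^ p - b * A ≤ poissonKernel 0 t (s : ℂ) * φ s x :=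
    fun s x => by
      have h1 := mul_le_mul_of_nonneg_left (hlo s x) (poissonKernel_pos ht s).le
      have h2 := mul_le_mul_of_nonneg_right (poissonKernel_le ht s) hA.le
      have h3 := mul_le_mul_of_nonneg_right (le_poissonKernel ht s)
        (by positivity : 0 ≤ c * ‖x‖ ^ p)
      linarith
  have hmid : ∀ f ∈ S, ∀ g ∈ S, (fun s => (1 / 2 : ℝ) • f s + (1 / 2 : ℝ) • g s) ∈ S := by
    rintro f ⟨hf, hft⟩ g ⟨hg, hgt⟩
    have h := hf.linComb hp.le hg (1 / 2) (1 / 2)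
    refine ⟨h.poissonExt, ?_⟩
    rw [← h.eq_poissonExt t ht, hft, hgt, ← add_smul]
    norm_num
  obtain ⟨f, hf, hmin⟩ := exists_integral_minimizer circleMeasure (p := p) (c := a * c)
    (A := b * A) (φ := fun (s : UnitCircle) x => poissonKernel 0 t (s : ℂ) * φ s x) hp
    (by positivity) (((continuous_poissonKernel ht).measurable.comp measurable_fst).mul hmeas)
    (fun s => (hcont s).const_mul _) hconv' hlo' hSne (fun f hf => hf.1.memLp)
    (fun f hf => Integrable.poissonKernel_smul
      (integrable_comp_of_growth hp hc hC hmeas hlo hhi hf.1.memLp) ht) hmid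
    (fun u f hu hf hlim => ⟨IsHardy.of_tendsto hp.le (fun k => (hu k).1) hf hlim,
      poissonExt_of_tendsto (fun k => (hu k).1.integrable hp.le)
        (hf.integrable (by simpa using hp.le)) hlim ht fun k => (hu k).2⟩)
  exact ⟨_, f, hf.1, hf.2, fun G g hG hGt =>
    hmin g ⟨hG.poissonExt, by rw [← hG.eq_poissonExt t ht, hGt]⟩⟩

/-- Through every point there passes a leaf, along which the interpolant is the Poisson integral
of the boundary data. -/
lemma exists_leaf (hpq : p.HolderConjugate q) (hc : 0 < c) (hC : 0 < C) (hA : 0 < A)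
    (hmeas : Measurable fun x : UnitCircle × Cn n => φ x.1 x.2)
    (hlo : ∀ s w, c * ‖w‖ ^ p - A ≤ φ s w) (hhi : ∀ s w, φ s w ≤ C * ‖w‖ ^ p + A)
    (hdiff : ∀ s, Differentiable ℝ (φ s)) (hconv : ∀ s, StrictConvexOn ℝ Set.univ (φ s))
    {t : ℂ} (ht : t ∈ unitDisk) (w : Cn n) :
    ∃ F f, IsHardy p F f ∧ F t = w ∧
      interpolant p φ t w = poissonExt (fun s => φ s (f s)) t := by
  obtain ⟨F, f, hF, hFt, hmin⟩ := exists_isHardy_minimizer hpq.lt hc hC hA hmeas hlo hhi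
    (fun s => (hdiff s).continuous) hconv ht w
  have hg := memLp_complexGradient hpq hc hC hA hmeas hlo hhi hdiff
    (fun s => (hconv s).convexOn) hF.memLp
  have hgi := hg.integrable (by simpa using hpq.symm.lt.le)
  -- Euler-Lagrange equation: adding `P(s) x` to the minimizer leaves its value at `t` unchanged
  -- exactly because `P` vanishes there.
  have hcrit : ∀ P : Polynomial ℂ, P.eval t = 0 →
      poissonExt (fun s => P.eval (s : ℂ) • complexGradient (φ s) (f s)) t = 0 := fun P hP => by
    have hder := hasFDerivAt_poissonExt hpq.lt hc hC hA hmeas hlo hhi hdiff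
      (fun s => (hconv s).convexOn) hF.memLp (m := fun s => P.eval (s : ℂ)) (by fun_prop) ht hgi
    have hlm : IsLocalMin (fun x : Cn n =>
        poissonExt (fun s => φ s (f s + P.eval (s : ℂ) • x)) t) 0 :=
      Filter.Eventually.of_forall fun x => by
        have := hmin _ _ (hF.add hpq.lt.le (isHardy_polynomial hpq.lt.le P x))
          (by simp [hP, hFt])
        simpa using this
    have h0 := hlm.hasFDerivAt_eq_zero hder
    refine eq_of_forall_re_dotC_eq fun v => ?_
    rw [← reDot_apply, h0]
    simp [dotC]
  have hG : IsHardy q (poissonExt fun s => complexGradient (φ s) (f s))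
      (fun s => complexGradient (φ s) (f s)) := by
    refine isHardy_of_momentsVanish hpq.symm.lt.le hg (fun j => ?_) fun _ _ => rfl
    refine momentsVanish_of_poissonExt_eq_zero
      ((EuclideanSpace.proj j : Cn n →L[ℂ] ℂ).integrable_comp hgi) ht fun k => ?_
    have h1 := hcrit ((Polynomial.X - Polynomial.C t) * Polynomial.X ^ k) (by simp)
    have h2 := poissonExt_smul_apply hgi (m := fun s =>
      ((Polynomial.X - Polynomial.C t) * Polynomial.X ^ k).eval (s : ℂ)) (by fun_prop) ht j
    rw [h1] at h2
    simpa [mul_assoc] using h2.symm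
  refine ⟨F, f, hF, hFt, ?_⟩
  rw [← hFt]
  exact interpolant_eq_poissonExt hpq hF hG
    (integrable_comp_of_growth hpq.lt hc hC hmeas hlo hhi hF.memLp)
    (fun s z => re_dotC_le_legendre_add (bddAbove_legendre hpq.lt hc (hlo s) z) (f s))
    (fun s => (legendre_complexGradient (hconv s).convexOn (hdiff s _)).le) ht

/-- The combination `α F + β G` of minimizers through `x` and `y` competes at `α x + β y`. Since `F
t ≠ G t`, the boundary functions cannot agree almost everywhere, so strict convexity of `φ s` gains
a positive integral. -/
lemma strictConvexOn_interpolant (hpq : p.HolderConjugate q) (hc : 0 < c) (hC : 0 < C)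
    (hA : 0 < A) (hmeas : Measurable fun x : UnitCircle × Cn n => φ x.1 x.2)
    (hlo : ∀ s w, c * ‖w‖ ^ p - A ≤ φ s w) (hhi : ∀ s w, φ s w ≤ C * ‖w‖ ^ p + A)
    (hdiff : ∀ s, Differentiable ℝ (φ s)) (hconv : ∀ s, StrictConvexOn ℝ Set.univ (φ s))
    {t : ℂ} (ht : t ∈ unitDisk) : StrictConvexOn ℝ Set.univ (interpolant p φ t) := by
  refine ⟨convex_univ, fun x _ y _ hxy α β hα hβ hαβ => ?_⟩
  obtain ⟨F, f, hF, hFt, hFx⟩ := exists_leaf hpq hc hC hA hmeas hlo hhi hdiff hconv ht x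
  obtain ⟨G, g, hG, hGt, hGy⟩ := exists_leaf hpq hc hC hA hmeas hlo hhi hdiff hconv ht y
  have hFG := hF.linComb hpq.lt.le hG α β
  have hle := interpolant_le_of_isHardy hpq hc hC hmeas hlo hhi hFG ht
  simp only [hFt, hGt] at hle
  refine hle.trans_lt ?_
  rw [hFx, hGy]
  have hint : ∀ {H : ℂ → Cn n} {h : UnitCircle → Cn n}, IsHardy p H h → Integrable
      (fun s : UnitCircle => poissonKernel 0 t (s : ℂ) • φ s (h s)) circleMeasure := fun hH =>
    Integrable.poissonKernel_smul
      (integrable_comp_of_growth hpq.lt hc hC hmeas hlo hhi hH.memLp) ht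
  have hsum := ((hint hF).const_mul α).add ((hint hG).const_mul β)
  set D : UnitCircle → ℝ := fun s => (α * (poissonKernel 0 t (s : ℂ) • φ s (f s)) +
    β * (poissonKernel 0 t (s : ℂ) • φ s (g s))) -
    poissonKernel 0 t (s : ℂ) • φ s (α • f s + β • g s) with hD
  have hDi : Integrable D circleMeasure := hsum.sub (hint hFG)
  have hDeq : ∀ s, D s = poissonKernel 0 t (s : ℂ) *
      (α * φ s (f s) + β * φ s (g s) - φ s (α • f s + β • g s)) := fun s => by
    simp only [hD, smul_eq_mul]; ring
  have hDpos : ∀ s, f s ≠ g s → 0 < D s := fun s hs => by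
    rw [hDeq]
    have := (hconv s).2 (Set.mem_univ _) (Set.mem_univ _) hs hα hβ hαβ
    simp only [smul_eq_mul] at this
    exact mul_pos (poissonKernel_pos ht s) (by linarith)
  have hD0 : 0 ≤ D := fun s => by
    rcases eq_or_ne (f s) (g s) with h | h
    · rw [hDeq, h, ← add_smul, ← add_mul, hαβ, one_smul, one_mul, sub_self, mul_zero]
      exact le_rfl
    · exact (hDpos s h).le
  have hint0 : 0 < ∫ s, D s ∂circleMeasure := by
    refine (integral_nonneg hD0).lt_of_ne fun h0 => hxy ?_
    have hz := (integral_eq_zero_iff_of_nonneg hD0 hDi).mp h0.symm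
    have hfg : f =ᵐ[circleMeasure] g := by
      filter_upwards [hz] with s hs
      by_contra hne
      exact (hDpos s hne).ne' hs
    rw [← hFt, ← hGt, hF.eq_poissonExt t ht, hG.eq_poissonExt t ht]
    exact poissonExt_congr_ae hfg t
  have hDint : ∫ s, D s ∂circleMeasure = (α * poissonExt (fun s => φ s (f s)) t +
      β * poissonExt (fun s => φ s (g s)) t) -
      poissonExt (fun s => φ s (α • f s + β • g s)) t := by
    simp only [poissonExt]
    rw [← integral_const_mul, ← integral_const_mul, ← integral_add ((hint hF).const_mul α)
      ((hint hG).const_mul β)]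
    exact integral_sub hsum (hint hFG)
  simp only [smul_eq_mul]
  linarith

/-- With `f` from `exists_leaf`, the function `x ↦ P[φ(s, f(s) + x)](t)` is differentiable at `0`
and touches the convex function `[φ]_t(w + x)` from above there. -/
lemma differentiable_interpolant (hpq : p.HolderConjugate q) (hc : 0 < c) (hC : 0 < C)
    (hA : 0 < A) (hmeas : Measurable fun x : UnitCircle × Cn n => φ x.1 x.2)
    (hlo : ∀ s w, c * ‖w‖ ^ p - A ≤ φ s w) (hhi : ∀ s w, φ s w ≤ C * ‖w‖ ^ p + A)
    (hdiff : ∀ s, Differentiable ℝ (φ s)) (hconv : ∀ s, StrictConvexOn ℝ Set.univ (φ s))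
    {t : ℂ} (ht : t ∈ unitDisk) : Differentiable ℝ (interpolant p φ t) := by
  intro w
  obtain ⟨F, f, hF, hFt, hFw⟩ := exists_leaf hpq hc hC hA hmeas hlo hhi hdiff hconv ht w
  have hgi := (memLp_complexGradient hpq hc hC hA hmeas hlo hhi hdiff
    (fun s => (hconv s).convexOn) hF.memLp).integrable (by simpa using hpq.symm.lt.le)
  have hder := hasFDerivAt_poissonExt hpq.lt hc hC hA hmeas hlo hhi hdiff
    (fun s => (hconv s).convexOn) hF.memLp (m := fun _ => 1) continuous_const ht hgi
  refine (hasFDerivAt_of_convexOn_of_le (strictConvexOn_interpolant hpq hc hC hA hmeas hlo hhi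
    hdiff hconv ht).convexOn hder (fun x => ?_) (by simpa using hFw)).differentiableAt
  have := interpolant_le_of_isHardy hpq hc hC hmeas hlo hhi
    (hF.add hpq.lt.le (isHardy_polynomial hpq.lt.le 1 x)) ht
  simpa [hFt] using this

/-- The gradient of the interpolant along a leaf is the Poisson integral of the gradient of the
boundary data; more generally this holds after multiplication with a polynomial. -/
lemma poissonExt_polynomial_smul_complexGradient (hpq : p.HolderConjugate q) (hc : 0 < c)
    (hC : 0 < C) (hA : 0 < A) (hmeas : Measurable fun x : UnitCircle × Cn n => φ x.1 x.2)
    (hlo : ∀ s w, c * ‖w‖ ^ p - A ≤ φ s w) (hhi : ∀ s w, φ s w ≤ C * ‖w‖ ^ p + A)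
    (hdiff : ∀ s, Differentiable ℝ (φ s)) (hconv : ∀ s, StrictConvexOn ℝ Set.univ (φ s))
    {F : ℂ → Cn n} {f : UnitCircle → Cn n} (hF : IsHardy p F f) {t : ℂ} (ht : t ∈ unitDisk)
    (hleaf : interpolant p φ t (F t) = poissonExt (fun s => φ s (f s)) t) (P : Polynomial ℂ) :
    poissonExt (fun s => P.eval (s : ℂ) • complexGradient (φ s) (f s)) t
      = P.eval t • complexGradient (interpolant p φ t) (F t) := by
  have hgi := (memLp_complexGradient hpq hc hC hA hmeas hlo hhi hdiff
    (fun s => (hconv s).convexOn) hF.memLp).integrable (by simpa using hpq.symm.lt.le)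
  have hder := hasFDerivAt_poissonExt hpq.lt hc hC hA hmeas hlo hhi hdiff
    (fun s => (hconv s).convexOn) hF.memLp (m := fun s => P.eval (s : ℂ)) (by fun_prop) ht hgi
  have h1 : HasFDerivAt (fun x : Cn n => F t + P.eval t • x)
      (P.eval t • ContinuousLinearMap.id ℝ (Cn n)) 0 :=
    ((hasFDerivAt_id (0 : Cn n)).const_smul (P.eval t)).const_add _
  have h2 : HasFDerivAt (interpolant p φ t) (fderiv ℝ (interpolant p φ t) (F t))
      (F t + P.eval t • (0 : Cn n)) := by
    rw [smul_zero, add_zero]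
    exact (differentiable_interpolant hpq hc hC hA hmeas hlo hhi hdiff hconv ht _).hasFDerivAt
  have h3 := hder.sub (h2.comp 0 h1)
  -- Here `P` need not vanish at `t`: the interpolant is evaluated at the shifted value `F t + P(t)
  -- x`, so weak duality still applies.
  have hlm : IsLocalMin ((fun x : Cn n =>
      poissonExt (fun s => φ s (f s + P.eval (s : ℂ) • x)) t) -
        (interpolant p φ t ∘ fun x : Cn n => F t + P.eval t • x)) 0 :=
    Filter.Eventually.of_forall fun x => by
      have h4 := interpolant_le_of_isHardy hpq hc hC hmeas hlo hhi
        (hF.add hpq.lt.le (isHardy_polynomial hpq.lt.le P x)) ht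
      simp only [Pi.sub_apply, Function.comp_apply, smul_zero, add_zero]
      rw [hleaf, sub_self]
      exact sub_nonneg.mpr h4
  have h0 := hlm.hasFDerivAt_eq_zero h3
  refine eq_of_forall_re_dotC_eq fun v => ?_
  have h5 := DFunLike.congr_fun (sub_eq_zero.mp h0) v
  rw [fderiv_eq_reDot] at h5
  rw [dotC_smul_left, ← dotC_smul_right]
  exact h5

/-- The gradient of the interpolant along a leaf is a Hardy function. -/
lemma isHardy_complexGradient (hpq : p.HolderConjugate q) (hc : 0 < c)
    (hC : 0 < C) (hA : 0 < A) (hmeas : Measurable fun x : UnitCircle × Cn n => φ x.1 x.2)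
    (hlo : ∀ s w, c * ‖w‖ ^ p - A ≤ φ s w) (hhi : ∀ s w, φ s w ≤ C * ‖w‖ ^ p + A)
    (hdiff : ∀ s, Differentiable ℝ (φ s)) (hconv : ∀ s, StrictConvexOn ℝ Set.univ (φ s))
    {F G : ℂ → Cn n} {f : UnitCircle → Cn n} (hF : IsHardy p F f)
    (hleaf : ∀ t ∈ unitDisk, interpolant p φ t (F t) = poissonExt (fun s => φ s (f s)) t)
    (hG : ∀ t ∈ unitDisk, G t = complexGradient (interpolant p φ t) (F t)) :
    IsHardy q G (fun s => complexGradient (φ s) (f s)) := by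
  have hg := memLp_complexGradient hpq hc hC hA hmeas hlo hhi hdiff
    (fun s => (hconv s).convexOn) hF.memLp
  have hgi := hg.integrable (by simpa using hpq.symm.lt.le)
  have hpoly := fun {t : ℂ} (ht : t ∈ unitDisk) => poissonExt_polynomial_smul_complexGradient hpq
    hc hC hA hmeas hlo hhi hdiff hconv hF ht (hleaf t ht)
  refine isHardy_of_momentsVanish hpq.symm.lt.le hg (fun j k => ?_) fun t ht => ?_
  · have h0 : (0 : ℂ) ∈ unitDisk := by simp
    -- At `t = 0` the kernel is identically one and `X ^ (k + 1)` vanishes, so the identity reads as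
    -- the vanishing of a moment.
    have h1 := hpoly h0 (Polynomial.X ^ (k + 1))
    have h2 := poissonExt_smul_apply hgi (m := fun s =>
      (Polynomial.X ^ (k + 1) : Polynomial ℂ).eval (s : ℂ)) (by fun_prop) h0 j
    rw [h1] at h2
    simpa [poissonExt, poissonKernel_coe] using h2.symm
  · have h1 := hpoly ht 1
    simp only [Polynomial.eval_one, one_smul] at h1
    rw [hG t ht, h1]

end Leaves

end DualFoliation

theorem mainTheorem6 (n : ℕ) (p : ℝ) (hp : 1 < p)
    (φ : DualFoliation.UnitCircle → DualFoliation.Cn n → ℝ)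
    (hmeas : Measurable fun x : DualFoliation.UnitCircle × DualFoliation.Cn n => φ x.1 x.2)
    (hgrowth : DualFoliation.UniformGrowth p φ)
    (hdiff : ∀ s, Differentiable ℝ (φ s))
    (hconv : ∀ s, StrictConvexOn ℝ Set.univ (φ s)) :
    (∀ t ∈ DualFoliation.unitDisk,
      Differentiable ℝ (DualFoliation.interpolant p φ t) ∧
      StrictConvexOn ℝ Set.univ (DualFoliation.interpolant p φ t)) ∧
    ∀ F ∈ DualFoliation.foliation p φ, ∀ G : ℂ → DualFoliation.Cn n,
      (∀ t ∈ DualFoliation.unitDisk,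
        G t = DualFoliation.complexGradient (DualFoliation.interpolant p φ t) (F t)) →
      DifferentiableOn ℂ G DualFoliation.unitDisk ∧
      G ∈ DualFoliation.foliation (p / (p - 1)) (fun s => DualFoliation.legendre (φ s)) ∧
      ∀ t ∈ DualFoliation.unitDisk,
        DualFoliation.interpolant p φ t (F t) +
          DualFoliation.interpolant (p / (p - 1)) (fun s => DualFoliation.legendre (φ s)) t (G t) =
        (DualFoliation.dotC (F t) (G t)).re := by
  obtain ⟨c, C, A, hc, hC, hA, hgr⟩ := hgrowth
  have hlo := fun s w => (hgr s w).1
  have hhi := fun s w => (hgr s w).2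
  have hpq : p.HolderConjugate (p / (p - 1)) := Real.HolderConjugate.conjExponent hp
  set q := p / (p - 1) with hq
  refine ⟨fun t ht =>
    ⟨DualFoliation.differentiable_interpolant hpq hc hC hA hmeas hlo hhi hdiff hconv ht,
      DualFoliation.strictConvexOn_interpolant hpq hc hC hA hmeas hlo hhi hdiff hconv ht⟩, ?_⟩
  rintro F ⟨f, hF, hleaf⟩ G hG
  have hGH := DualFoliation.isHardy_complexGradient hpq hc hC hA hmeas hlo hhi hdiff hconv hF
    hleaf hG
  have hbdd := fun s z => DualFoliation.bddAbove_legendre hpq.lt hc (hlo s) z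
  have hfen := fun s => DualFoliation.legendre_complexGradient (hconv s).convexOn (hdiff s (f s))
  have hφi := DualFoliation.integrable_comp_of_growth hpq.lt hc hC hmeas hlo hhi hF.memLp
  have hdot := DualFoliation.integrable_dotC hpq hF.memLp hGH.memLp
  have hfen2 : ∀ s, DualFoliation.legendre (φ s) (DualFoliation.complexGradient (φ s) (f s)) =
      (DualFoliation.dotC (f s) (DualFoliation.complexGradient (φ s) (f s))).re - φ s (f s) :=
    fun s => by rw [hfen s, DualFoliation.dotC_comm]
  have hli : MeasureTheory.Integrable (fun s => DualFoliation.legendre (φ s)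
      (DualFoliation.complexGradient (φ s) (f s))) DualFoliation.circleMeasure := by
    simp only [hfen2]
    exact (DualFoliation.integrable_complex_re hdot).sub hφi
  have hdual : ∀ t ∈ DualFoliation.unitDisk,
      DualFoliation.interpolant q (fun s => DualFoliation.legendre (φ s)) t (G t) =
        DualFoliation.poissonExt (fun s => DualFoliation.legendre (φ s)
          (DualFoliation.complexGradient (φ s) (f s))) t := fun t ht => by
    refine DualFoliation.interpolant_eq_poissonExt hpq.symm hGH hF hli (fun s z =>
      DualFoliation.re_dotC_le_legendre_add
        (DualFoliation.bddAbove_legendre_legendre (hbdd s) z) _) (fun s => ?_) ht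
    -- In the dual problem `F` is the competitor, and admissibility only asks for an upper bound of
    -- the biconjugate. The easy half of Fenchel-Moreau suffices.
    have := DualFoliation.legendre_legendre_le (hbdd s) (f s)
    rw [hfen2 s]
    linarith
  refine ⟨hGH.holomorphic, ⟨_, hGH, hdual⟩, fun t ht => ?_⟩
  rw [hleaf t ht, hdual t ht]
  simp only [hfen2]
  rw [DualFoliation.poissonExt_sub (DualFoliation.integrable_complex_re hdot) hφi ht,
    DualFoliation.poissonExt_re hdot ht, DualFoliation.poissonExt_dotC hpq hF hGH ht]
  ring
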